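/- **Conventions.** For $x\in\mathbb R$ and $q\in\mathbb N$ let $[x]_q=\lfloor qx\rfloor/q$, applied componentwise to vectors. $H(D)$ is the Shannon entropy of a discrete random element $D$, and $H(D\mid Y)$ is the entropy of the conditional law of $D$ given $Y=y$, averaged over the law of $Y$. The Rényi information dimension (RID) of a real random variable $X$ and the conditional RID of $X$ given a random vector $Y$ are $$d(X)=\lim_{q\to\infty}\frac{H([X]_q)}{\log q},\qquad d(X\mid Y)=\lim_{q\to\infty}\frac{H([X]_q\mid Y)}{\log q},$$ when these limits exist (entropies and $\log q$ in the same base). For $N=2^n$, $H_N$ is the Hadamard matrix given by $H_1=(1)$, $H_{2N}=\begin{pmatrix}H_N&H_N\\H_N&-H_N\end{pmatrix}$; a partial Hadamard matrix is a matrix formed by a subset of the rows of $H_N$. A family of $m_N\times N$ matrices $\{\Phi_N\}$, with $N$ running through a subsequence of $\mathbb N$, is $\epsilon$-REP for an i.i.d. source $X_1,X_2,\dots$ with measurement rate $\rho$ if $$\limsup_{q\to\infty}\frac{H([X_1^N]_q\mid\Phi_NX_1^N)}{H([X_1^N]_q)}\le\epsilon\quad\text{for every }N\text{ in the family},\qquad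 \limsup_{N\to\infty}\frac{m_N}{N}=\rho .$$ **Theorem.** Let $X_1,X_2,\dots$ be i.i.d. real random variables with finite second moment and nonsingular law (the law is the sum of a discrete measure and a measure that is absolutely continuous with respect to Lebesgue measure). Then $d(X_1)$ exists and, with $Z_1^N=H_NX_1^N$, so do all the conditional RIDs $I_n(i)=d(Z_i\mid Z_1^{i-1})$, $N=2^n$, $1\le i\le N$. Suppose moreover that $d(X_1)>0$. Then for every $\epsilon>0$ there is a family of partial Hadamard matrices $\Phi_N$ of dimension $m_N\times N$, $N=2^n$, $n=0,1,2,\dots$, which is $\epsilon$-REP with measurement rate $\rho=d(X_1)$. If $\epsilon\, d(X_1)<1$ or $\epsilon=1$ (in particular for every $0<\epsilon\le1$), the family obtained by keeping exactly the rows $i$ of $H_N$ with $I_n(i)\ge\epsilon\,d(X_1)$ has this property. -/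

import Mathlib

open MeasureTheory ProbabilityTheory Filter Topology
open scoped ENNReal NNReal Matrix

noncomputable section

/-- The uniform quantization `[x]_q = ⌊q x⌋ / q` with step `1 / q`. -/
def quantize (q : ℕ) (x : ℝ) : ℝ := (⌊(q : ℝ) * x⌋ : ℝ) / (q : ℝ)

/-- The Shannon entropy `∑ - p log p` of a discrete probability measure, as an extended
nonnegative real. Natural logarithms are used throughout; below, entropies occur only divided by
another entropy or by `log q`, so the base of the logarithm is immaterial. -/
def shannonEntropy {E : Type*} [MeasurableSpace E] (μ : Measure E) : ℝ≥0∞ :=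
  ∑' x : E, ENNReal.ofReal (Real.negMulLog (μ.real {x}))

/-- The conditional entropy `H(D | Y)` of a discrete random element `D` given an arbitrary random
element `Y`: the entropy of the regular conditional law of `D` given `Y = y`, averaged over the
law of `Y`. -/
def condShannonEntropy {Ω E F : Type*} [MeasurableSpace Ω] [MeasurableSpace E]
    [StandardBorelSpace E] [Nonempty E] [MeasurableSpace F]
    (P : Measure Ω) [IsFiniteMeasure P] (D : Ω → E) (Y : Ω → F) : ℝ≥0∞ :=
  ∫⁻ y, shannonEntropy (condDistrib D Y P y) ∂(P.map Y)

/-- A law on the line is nonsingular if it is the sum of a discrete measure (carried by a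
countable set) and a measure that is absolutely continuous with respect to Lebesgue measure. -/
def IsNonsingularLaw (μ : Measure ℝ) : Prop :=
  ∃ μd μc : Measure ℝ, μ = μd + μc ∧ (∃ C : Set ℝ, C.Countable ∧ μd Cᶜ = 0) ∧ μc ≪ volume

/-- `d(X)` exists and equals `d`: `H([X]_q) / log q → d` as `q → ∞`. -/
def HasRID {Ω : Type*} [MeasurableSpace Ω] (P : Measure Ω) (X : Ω → ℝ) (d : ℝ≥0) : Prop :=
  Tendsto (fun q : ℕ =>
      shannonEntropy (P.map (fun ω => quantize q (X ω))) / ENNReal.ofReal (Real.log q))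
    atTop (𝓝 (d : ℝ≥0∞))

/-- `d(X | Y)` exists and equals `d`: `H([X]_q | Y) / log q → d` as `q → ∞`. -/
def HasCondRID {Ω F : Type*} [MeasurableSpace Ω] [MeasurableSpace F] (P : Measure Ω)
    [IsFiniteMeasure P] (X : Ω → ℝ) (Y : Ω → F) (d : ℝ≥0) : Prop :=
  Tendsto (fun q : ℕ =>
      condShannonEntropy P (fun ω => quantize q (X ω)) Y / ENNReal.ofReal (Real.log q))
    atTop (𝓝 (d : ℝ≥0∞))

/-- The Hadamard matrix of order `2 ^ n`, with entries `±1`: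
`H_1 = (1)` and `H_{2N} = [H_N, H_N; H_N, -H_N]`. -/
def hadamardMatrix : (n : ℕ) → Matrix (Fin (2 ^ n)) (Fin (2 ^ n)) ℝ
  | 0 => Matrix.of fun _ _ => 1
  | n + 1 =>
    let e : Fin (2 ^ n) ⊕ Fin (2 ^ n) ≃ Fin (2 ^ (n + 1)) :=
      finSumFinEquiv.trans (finCongr (by rw [pow_succ, mul_two]))
    Matrix.reindex e e (Matrix.fromBlocks (hadamardMatrix n) (hadamardMatrix n)
      (hadamardMatrix n) (-hadamardMatrix n))

/-- The full measurements `Z_1^N = H_N X_1^N`, `N = 2 ^ n`, of the first `N` source symbols. -/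
def hadamardMeasurement {Ω : Type*} (X : ℕ → Ω → ℝ) (n : ℕ) (ω : Ω) : Fin (2 ^ n) → ℝ :=
  hadamardMatrix n *ᵥ fun j => X j ω

/-- The partial Hadamard matrix consisting of the rows of `H_N`, `N = 2 ^ n`, with index in `S`,
in their original order. -/
def partialHadamard (n : ℕ) (S : Finset (Fin (2 ^ n))) : Matrix (Fin S.card) (Fin (2 ^ n)) ℝ :=
  (hadamardMatrix n).submatrix (S.orderEmbOfFin rfl) id

/-- The family of matrices `Φ k`, of dimension `m k × N k` with `N` a subsequence of the positive
integers, is `ε`-REP for the i.i.d. source `X` with measurement rate `ρ`: for every member of the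
family, `limsup_q H([X_1^N]_q | Φ_N X_1^N) / H([X_1^N]_q) ≤ ε`, and `limsup_N m_N / N = ρ`. -/
structure IsREP {Ω : Type*} [MeasurableSpace Ω] (P : Measure Ω) [IsFiniteMeasure P]
    (X : ℕ → Ω → ℝ) (ε : ℝ) (ρ : ℝ≥0) (N m : ℕ → ℕ)
    (Φ : ∀ k, Matrix (Fin (m k)) (Fin (N k)) ℝ) : Prop where
  pos : ∀ k, 0 < N k
  strictMono : StrictMono N
  limsup_entropy_le : ∀ k,
    limsup (fun q : ℕ =>
      condShannonEntropy P (fun ω (i : Fin (N k)) => quantize q (X i ω))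
          (fun ω => Φ k *ᵥ fun i : Fin (N k) => X i ω)
        / shannonEntropy (P.map (fun ω (i : Fin (N k)) => quantize q (X i ω)))) atTop
      ≤ ENNReal.ofReal ε
  rate : limsup (fun k => (m k : ℝ≥0∞) / (N k : ℝ≥0∞)) atTop = (ρ : ℝ≥0∞)

end

/-! Fix a countable set `D` off which the law of the source is absolutely continuous; the dimension
of the source is then `d = P(X ∉ D)`. Let `C` be the random set of coordinates where the source
avoids `D`. Row `i` of the Hadamard matrix is free on `C` if some vector supported on `C` is killed
by all earlier rows but not by row `i`. The conditional dimension of `Z_i` given the earlier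
measurements is the probability that row `i` is free (`hasCondRID_hadamardMeasurement`).

The upper bound is Gibbs' inequality: once the values in a finite part of `D` are known, the unknown
vector ranges over a translate of a subspace, a few coordinates determine the others, and products
of Gaussian cell masses on these coordinates serve as reference weights
(`limsup_condShannonEntropy_div_log_le`). For the lower bound, translation along a vector witnessing
freeness fixes the earlier measurements and moves `Z_i`, so the conditional law of `Z_i` has an
absolutely continuous part of sufficient mass; differentiation of measures and Fatou's lemma
conclude (`le_liminf_condShannonEntropy_div_log`).

In the even-odd recursion for the Hadamard matrix, row `2i` is free iff row `i` is free on one of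
two independent halves, and row `2i+1` iff it is free on both. The probabilities therefore split as
`p ↦ 2p - p²` and `p ↦ p²`, as for polar codes on the erasure channel: their mean stays `d`, while
`∑ √(p(1-p))` grows at most like `√3 ^ n`, which is negligible against `2 ^ n`. So for a threshold
in `(0, 1)` the fraction of rows above it tends to `d` (`IsErasureProcess.tendsto_card_div`). Each
discarded row costs less than `ε d` in dimension, hence at most `ε N d` in all, against a total
dimension `N d`. -/

/-! ### Quantization and the entropy of discrete random elements. -/

theorem measurable_quantize (q : ℕ) : Measurable (quantize q) := by
  unfold quantize
  fun_prop

theorem countable_range_quantize (q : ℕ) : (Set.range (quantize q)).Countable := by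
  refine (Set.countable_range fun k : ℤ => (k : ℝ) / (q : ℝ)).mono ?_
  rintro _ ⟨x, rfl⟩
  exact ⟨_, rfl⟩

theorem countable_range_quantize_pi {ι : Type*} [Finite ι] {α : Type*} (q : ℕ) (f : α → ι → ℝ) :
    (Set.range fun x j => quantize q (f x j)).Countable := by
  refine (Set.countable_univ_pi fun _ : ι => countable_range_quantize q).mono ?_
  rintro _ ⟨x, rfl⟩ j -
  exact ⟨_, rfl⟩

theorem Set.Countable.measurable_indicator {E : Type*} [MeasurableSpace E]
    [MeasurableSingletonClass E] {K : Set E} (hK : K.Countable) (f : E → ℝ≥0∞) :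
    Measurable (K.indicator f) := by
  intro s hs
  by_cases h0 : (0 : ℝ≥0∞) ∈ s
  · have : (K.indicator f ⁻¹' s)ᶜ.Countable := by
      refine hK.mono fun v hv => ?_
      by_contra hvK
      exact hv (by simpa [Set.indicator_of_notMem hvK] using h0)
    exact this.measurableSet.of_compl
  · have : (K.indicator f ⁻¹' s).Countable := by
      refine hK.mono fun v hv => ?_
      by_contra hvK
      exact h0 (by simpa [Set.indicator_of_notMem hvK] using hv)
    exact this.measurableSet

theorem measurable_comp_of_countable_range {α E β : Type*} [MeasurableSpace α]
    [MeasurableSpace E] [MeasurableSingletonClass E] [MeasurableSpace β] {D : α → E}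
    (hD : Measurable D) (hK : (Set.range D).Countable) (f : E → β) :
    Measurable fun x => f (D x) := fun s _ => by
  have : (fun x => f (D x)) ⁻¹' s = D ⁻¹' (Set.range D ∩ f ⁻¹' s) := by ext; simp
  rw [this]
  exact hD (hK.mono Set.inter_subset_left).measurableSet

/-- Integrals of functions of a discrete random element are sums over its values. -/
theorem lintegral_comp_eq_tsum {α E : Type*} [MeasurableSpace α] [MeasurableSpace E]
    [MeasurableSingletonClass E] (κ : Measure α) {D : α → E} (hD : Measurable D)
    (hK : (Set.range D).Countable) (f : E → ℝ≥0∞) :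
    ∫⁻ x, f (D x) ∂κ = ∑' v, f v * (κ.map D) {v} := by
  have hm : Measurable ((Set.range D).indicator f) := hK.measurable_indicator f
  have h1 : ∫⁻ x, f (D x) ∂κ = ∫⁻ v, (Set.range D).indicator f v ∂(κ.map D) := by
    rw [lintegral_map hm hD]
    exact lintegral_congr fun x => by simp
  rw [h1, lintegral_indicator hK.measurableSet, lintegral_countable _ hK,
    ← tsum_subtype_eq_of_support_subset (f := fun v => f v * (κ.map D) {v}) (s := Set.range D)]
  intro v hv
  by_contra hvK
  refine hv ?_
  have : D ⁻¹' {v} = ∅ := by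
    ext x
    simp only [Set.mem_preimage, Set.mem_singleton_iff, Set.mem_empty_iff_false, iff_false]
    rintro rfl
    exact hvK ⟨x, rfl⟩
  simp [Measure.map_apply hD (measurableSet_singleton v), this]

/-- The values of mass zero are countably many, so they are almost surely not taken. This keeps
logarithms of masses away from the default `Real.log 0 = 0`. -/
theorem ae_map_singleton_pos {α E : Type*} [MeasurableSpace α] [MeasurableSpace E]
    [MeasurableSingletonClass E] (κ : Measure α) [IsFiniteMeasure κ] {D : α → E}
    (hD : Measurable D) (hK : (Set.range D).Countable) :
    ∀ᵐ x ∂κ, 0 < (κ.map D).real {D x} := by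
  have : ∫⁻ x, (if 0 < (κ.map D).real {D x} then 0 else 1 : ℝ≥0∞) ∂κ = 0 := by
    rw [lintegral_comp_eq_tsum κ hD hK fun v => if 0 < (κ.map D).real {v} then 0 else 1]
    refine ENNReal.tsum_eq_zero.2 fun v => ?_
    split_ifs with h
    · simp
    · have : (κ.map D).real {v} = 0 := le_antisymm (not_lt.1 h) measureReal_nonneg
      rw [measureReal_eq_zero_iff] at this
      simp [this]
  have hm : Measurable fun x => (if 0 < (κ.map D).real {D x} then 0 else 1 : ℝ≥0∞) :=
    measurable_comp_of_countable_range hD hK fun v => if 0 < (κ.map D).real {v} then 0 else 1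
  rw [lintegral_eq_zero_iff hm] at this
  filter_upwards [this] with x hx
  by_contra h
  simp [h] at hx

/-- The entropy of a discrete random element is the mean of its information content. -/
theorem shannonEntropy_map_eq_lintegral {α E : Type*} [MeasurableSpace α] [MeasurableSpace E]
    [MeasurableSingletonClass E] (κ : Measure α) [IsFiniteMeasure κ] {D : α → E}
    (hD : Measurable D) (hK : (Set.range D).Countable) :
    shannonEntropy (κ.map D) = ∫⁻ x, ENNReal.ofReal (-Real.log ((κ.map D).real {D x})) ∂κ := by
  rw [lintegral_comp_eq_tsum κ hD hK fun v => ENNReal.ofReal (-Real.log ((κ.map D).real {v}))]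
  refine tsum_congr fun v => ?_
  rw [Real.negMulLog, neg_mul_comm, ENNReal.ofReal_mul measureReal_nonneg, mul_comm,
    ofReal_measureReal]

/-- Gibbs' inequality, with a family of finitely many reference weights. -/
theorem shannonEntropy_map_le {α E W : Type*} [MeasurableSpace α] [MeasurableSpace E]
    [MeasurableSingletonClass E] [Fintype W] (κ : Measure α) [IsFiniteMeasure κ] {D : α → E}
    (hD : Measurable D) (hK : (Set.range D).Countable) (w : α → W) (r : W → E → ℝ)
    (hr : ∀ w v, 0 ≤ r w v) (hpos : ∀ᵐ x ∂κ, 0 < r (w x) (D x)) :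
    shannonEntropy (κ.map D) ≤ ∫⁻ x, ENNReal.ofReal (-Real.log (r (w x) (D x))) ∂κ +
      ∑ w, ∑' v, ENNReal.ofReal (r w v) := by
  set p : E → ℝ := fun v => (κ.map D).real {v}
  -- The index `w x` need not be a function of `D x`; summing the likelihood ratios over all indices
  -- gives a function of `D x` alone, which can be integrated against the law of `D`.
  set g : E → ℝ≥0∞ := fun v => ∑ w, ENNReal.ofReal (r w v / p v)
  have hg : ∫⁻ x, g (D x) ∂κ ≤ ∑ w, ∑' v, ENNReal.ofReal (r w v) := by
    rw [lintegral_comp_eq_tsum κ hD hK g,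
      ← Summable.tsum_finsetSum fun _ _ => ENNReal.summable]
    refine ENNReal.tsum_le_tsum fun v => ?_
    rw [Finset.sum_mul]
    refine Finset.sum_le_sum fun w _ => ?_
    rw [← ofReal_measureReal (μ := κ.map D) (s := {v}),
      ← ENNReal.ofReal_mul (div_nonneg (hr w v) measureReal_nonneg)]
    refine ENNReal.ofReal_le_ofReal ?_
    rcases eq_or_ne ((κ.map D).real {v}) 0 with h | h
    · simp [h, hr w v]
    · exact (div_mul_cancel₀ _ h).le
  have hgm : AEMeasurable (fun x => g (D x)) κ :=
    (measurable_comp_of_countable_range hD hK g).aemeasurable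
  rw [shannonEntropy_map_eq_lintegral κ hD hK]
  calc ∫⁻ x, ENNReal.ofReal (-Real.log (p (D x))) ∂κ
      ≤ ∫⁻ x, (ENNReal.ofReal (-Real.log (r (w x) (D x))) + g (D x)) ∂κ := by
        refine lintegral_mono_ae ?_
        filter_upwards [hpos, ae_map_singleton_pos κ hD hK] with x hx hp
        refine le_trans ?_ (add_le_add_right (Finset.single_le_sum
          (f := fun w => ENNReal.ofReal (r w (D x) / p (D x))) (fun _ _ => zero_le)
          (Finset.mem_univ (w x))) _)
        refine le_trans (ENNReal.ofReal_le_ofReal ?_) ENNReal.ofReal_add_le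
        have h := Real.log_le_sub_one_of_pos (div_pos hx hp)
        rw [Real.log_div hx.ne' hp.ne'] at h
        change -Real.log ((κ.map D).real {D x}) ≤ _ + r (w x) (D x) / (κ.map D).real {D x}
        linarith
    _ = ∫⁻ x, ENNReal.ofReal (-Real.log (r (w x) (D x))) ∂κ + ∫⁻ x, g (D x) ∂κ :=
        lintegral_add_right' _ hgm
    _ ≤ _ := add_le_add_right hg _

/-! ### Quantization cells and their Gaussian mass. -/

theorem quantize_eq_iff {q : ℕ} (hq : 0 < q) (x u : ℝ) :
    quantize q u = quantize q x ↔ ⌊(q : ℝ) * u⌋ = ⌊(q : ℝ) * x⌋ := by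
  have : (q : ℝ) ≠ 0 := by positivity
  simp [quantize, div_left_inj' this]

theorem setOf_quantize_eq {q : ℕ} (hq : 0 < q) (x : ℝ) :
    {u | quantize q u = quantize q x} = Set.Ico (quantize q x) (quantize q x + 1 / q) := by
  have hq' : (0 : ℝ) < q := by positivity
  ext u
  rw [Set.mem_ofPred_eq, quantize_eq_iff hq, Int.floor_eq_iff, Set.mem_Ico, quantize, ← add_div,
    div_le_iff₀' hq', lt_div_iff₀' hq']

theorem quantize_le {q : ℕ} (hq : 0 < q) (x : ℝ) : quantize q x ≤ x := by
  have hq' : (0 : ℝ) < q := by positivity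
  rw [quantize, div_le_iff₀' hq']
  exact Int.floor_le _

theorem lt_quantize_add {q : ℕ} (hq : 0 < q) (x : ℝ) : x < quantize q x + 1 / q := by
  have : x ∈ Set.Ico (quantize q x) (quantize q x + 1 / q) := by
    rw [← setOf_quantize_eq hq]; rfl
  exact this.2

/-- The cell has length `1 / q ≤ 1`, so `u² ≤ 2x² + 2` for every `u` in it; with `√(2π) ≤ e` the
density is at least `exp (-(x² + 2))` there. The information content under this reference law is
thus `log q` plus a quadratic term, integrable under a second moment. -/
theorem le_gaussianReal_quantize {q : ℕ} (hq : 0 < q) (x : ℝ) :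
    Real.exp (-(x ^ 2 + 2)) / q ≤ (gaussianReal 0 1).real {u | quantize q u = quantize q x} := by
  have hq' : (0 : ℝ) < q := by positivity
  have hq1 : (1 : ℝ) / q ≤ 1 := by
    rw [div_le_one hq']; exact_mod_cast hq
  rw [measureReal_def, ← ENNReal.ofReal_le_iff_le_toReal (measure_ne_top _ _),
    gaussianReal_apply 0 one_ne_zero, setOf_quantize_eq hq]
  calc ENNReal.ofReal (Real.exp (-(x ^ 2 + 2)) / q)
      = ∫⁻ _ in Set.Ico (quantize q x) (quantize q x + 1 / q),
          ENNReal.ofReal (Real.exp (-(x ^ 2 + 2))) := by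
        rw [setLIntegral_const, Real.volume_Ico, ← ENNReal.ofReal_mul (Real.exp_pos _).le]
        congr 1
        ring
    _ ≤ _ := by
        refine setLIntegral_mono' measurableSet_Ico fun u hu => ENNReal.ofReal_le_ofReal ?_
        have h1 := quantize_le hq x
        have h2 := lt_quantize_add hq x
        have hu2 : u ^ 2 ≤ 2 * x ^ 2 + 2 := by nlinarith [hu.1, hu.2, sq_nonneg (2 * x - u)]
        have hpi : √(2 * Real.pi) ≤ Real.exp 1 := by
          rw [Real.sqrt_le_left (Real.exp_pos _).le]
          nlinarith [Real.pi_lt_d2, Real.exp_one_gt_d9]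
        rw [gaussianPDFReal_def]
        simp only [NNReal.coe_one, mul_one, sub_zero]
        have : Real.exp (-(x ^ 2 + 2)) = (Real.exp 1)⁻¹ * Real.exp (-(x ^ 2 + 1)) := by
          rw [← Real.exp_neg, ← Real.exp_add]; ring_nf
        rw [this]
        gcongr
        linarith

theorem neg_log_gaussianReal_quantize_le {q : ℕ} (hq : 0 < q) (x : ℝ) :
    -Real.log ((gaussianReal 0 1).real {u | quantize q u = quantize q x}) ≤
      Real.log q + (x ^ 2 + 2) := by
  have hq' : (0 : ℝ) < q := by positivity
  have h := Real.log_le_log (by positivity) (le_gaussianReal_quantize hq x)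
  rw [Real.log_div (Real.exp_pos _).ne' hq'.ne', Real.log_exp] at h
  linarith

/-! ### Entropy on pieces of low dimension. -/

/-- On a subspace of dimension `k`, some `k` coordinates determine all coordinates. -/
theorem Submodule.exists_finset_coord {ι : Type*} [Fintype ι] [DecidableEq ι]
    (V : Submodule ℝ (ι → ℝ)) :
    ∃ (T : Finset ι) (L : ι → ι → ℝ), T.card = Module.finrank ℝ V ∧
      ∀ x ∈ V, ∀ j, x j = ∑ t ∈ T, L j t * x t := by
  set v : ι → Module.Dual ℝ V := fun j => (LinearMap.proj j).comp V.subtype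
  -- The coordinate functionals separate the points of `V`, hence span its dual, and a basis of the
  -- dual can be selected among them.
  have hspan : Submodule.span ℝ (Set.range v) = ⊤ := by
    have : (Submodule.span ℝ (Set.range v)).dualCoannihilator = ⊥ := by
      refine (Submodule.eq_bot_iff _).2 fun x hx => Subtype.ext (funext fun j => ?_)
      exact (Submodule.mem_dualCoannihilator x).1 hx (v j) (Submodule.subset_span ⟨j, rfl⟩)
    rw [← Subspace.dualCoannihilator_dualAnnihilator_eq (W := Submodule.span ℝ (Set.range v)),
      this, Submodule.dualAnnihilator_bot]
  obtain ⟨κ, a, ha, hsp, hli⟩ := exists_linearIndependent' ℝ v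
  have : Finite κ := Finite.of_injective a ha
  have := Fintype.ofFinite κ
  have hcard : Fintype.card κ = Module.finrank ℝ V := by
    rw [← Subspace.dual_finrank_eq (K := ℝ) (V := V), ← finrank_top ℝ (Module.Dual ℝ V), ← hspan,
      ← hsp, finrank_span_eq_card hli]
  have hmem : ∀ j, ∃ c : κ → ℝ, ∑ k, c k • v (a k) = v j := fun j => by
    have : v j ∈ Submodule.span ℝ (Set.range (v ∘ a)) :=
      hsp ▸ Submodule.subset_span ⟨j, rfl⟩
    exact (Submodule.mem_span_range_iff_exists_fun ℝ).1 this
  choose c hc using hmem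
  refine ⟨Finset.univ.image a, fun j t => ∑ k, if a k = t then c j k else 0, ?_, ?_⟩
  · rw [Finset.card_image_of_injective _ ha, Finset.card_univ, hcard]
  · intro x hx j
    have := DFunLike.congr_fun (hc j) ⟨x, hx⟩
    simp only [LinearMap.sum_apply, LinearMap.smul_apply, v, LinearMap.comp_apply,
      Submodule.subtype_apply, LinearMap.proj_apply, smul_eq_mul] at this
    rw [← this, Finset.sum_image fun _ _ _ _ h => ha h]
    refine Finset.sum_congr rfl fun k _ => ?_
    dsimp only
    rw [Finset.sum_eq_single_of_mem k (Finset.mem_univ k) fun l _ hl => if_neg (ha.ne hl), if_pos rfl]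

/-- A vector `v` of `Q` is encoded injectively by its `T`-coordinates and its difference from a
chosen member of `Q` with the same `T`-coordinates. The masses of the first component sum to at most
one, since the cells are disjoint; the second takes at most `(2b + 1) ^ card ι` values. -/
theorem tsum_prod_gaussianReal_le {ι : Type*} [Fintype ι] [DecidableEq ι] (q : ℕ)
    (T : Finset ι) (b : ℕ) (Q : Set (ι → ℝ))
    (hQ : ∀ v ∈ Q, ∀ v' ∈ Q, (∀ t ∈ T, v t = v' t) →
      ∀ j, ∃ z : ℤ, |z| ≤ b ∧ v j - v' j = z / q) :
    ∑' v, Q.indicator (fun v => ∏ t ∈ T, gaussianReal 0 1 {u | quantize q u = v t}) v ≤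
      ((2 * b + 1) ^ Fintype.card ι : ℕ) := by
  classical
  set γ := gaussianReal 0 1
  set g : (T → ℝ) → ℝ≥0∞ := fun u => ∏ t, γ {x | quantize q x = u t}
  have hg : ∑' u, g u ≤ 1 := by
    have h1 : ∀ u, g u = Measure.pi (fun _ : T => γ) (Set.univ.pi fun t => {x | quantize q x = u t}) :=
      fun u => (Measure.pi_pi _ _).symm
    simp_rw [h1]
    refine (tsum_meas_le_meas_iUnion_of_disjoint _ ?_ ?_).trans prob_le_one
    · exact fun u => MeasurableSet.univ_pi fun t =>
        measurable_quantize q (measurableSet_singleton _)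
    · intro u u' huu
      refine Set.disjoint_left.2 fun x hx hx' => huu (funext fun t => ?_)
      exact (hx t trivial).symm.trans (hx' t trivial)
  set O : Finset (ι → ℝ) :=
    Fintype.piFinset fun _ => (Finset.Icc (-b : ℤ) b).image fun z : ℤ => (z : ℝ) / (q : ℝ)
  have hO : O.card ≤ (2 * b + 1) ^ Fintype.card ι := by
    rw [Fintype.card_piFinset, Finset.prod_const, Finset.card_univ]
    refine Nat.pow_le_pow_left (Finset.card_image_le.trans ?_) _
    rw [Int.card_Icc]
    omega
  let w : (T → ℝ) → ι → ℝ := fun u =>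
    if h : ∃ v ∈ Q, ∀ t : T, v t = u t then h.choose else 0
  have hw : ∀ v ∈ Q, w (fun t => v t) ∈ Q ∧ ∀ t : T, w (fun t => v t) t = v t := fun v hv => by
    have h : ∃ v' ∈ Q, ∀ t : T, v' t = v t := ⟨v, hv, fun _ => rfl⟩
    simp only [w, dif_pos h]
    exact h.choose_spec
  set φ : (ι → ℝ) → (T → ℝ) × (ι → ℝ) := fun v => (fun t => v t, v - w fun t => v t)
  have hφ : Function.Injective φ := fun v v' h => by
    have h1 : (fun t : T => v t) = fun t : T => v' t := (Prod.ext_iff.1 h).1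
    have h2 : v - w (fun t => v t) = v' - w (fun t => v' t) := (Prod.ext_iff.1 h).2
    rw [h1] at h2
    exact sub_left_injective h2
  calc ∑' v, Q.indicator (fun v => ∏ t ∈ T, γ {u | quantize q u = v t}) v
      ≤ ∑' v, (fun p : (T → ℝ) × (ι → ℝ) => g p.1 * (O : Set (ι → ℝ)).indicator 1 p.2) (φ v) := by
        refine ENNReal.tsum_le_tsum fun v => ?_
        by_cases hv : v ∈ Q
        · have hmem : v - w (fun t => v t) ∈ (O : Set (ι → ℝ)) := by
            simp only [O, Finset.mem_coe, Fintype.mem_piFinset, Finset.mem_image, Finset.mem_Icc]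
            intro j
            obtain ⟨z, hz, hz'⟩ := hQ v hv _ (hw v hv).1
              (fun t ht => ((hw v hv).2 ⟨t, ht⟩).symm) j
            exact ⟨z, abs_le.1 hz, hz'.symm⟩
          simp only [Set.indicator_of_mem hv, φ, Set.indicator_of_mem hmem, Pi.one_apply, mul_one, g]
          exact (Finset.prod_coe_sort T fun t => γ {u | quantize q u = v t}).ge
        · simp [Set.indicator_of_notMem hv]
    _ ≤ ∑' p : (T → ℝ) × (ι → ℝ), g p.1 * (O : Set (ι → ℝ)).indicator 1 p.2 :=
        ENNReal.tsum_comp_le_tsum_of_injective hφ _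
    _ = (∑' u, g u) * O.card := by
        rw [ENNReal.tsum_prod']
        simp_rw [ENNReal.tsum_mul_left, ENNReal.tsum_mul_right]
        congr 1
        rw [← tsum_subtype, Finset.tsum_subtype']
        simp
    _ ≤ _ := by
        refine (mul_le_mul' hg le_rfl).trans ?_
        rw [one_mul]
        exact_mod_cast hO

/-- If, on each of finitely many pieces of `Γ`, the values of `V` differ by elements of a
`k`-dimensional space, the quantization of `V` has entropy at most the mean of `k log q` plus a
constant. -/
theorem exists_shannonEntropy_map_quantize_le {α ι W : Type*} [MeasurableSpace α] [Fintype ι]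
    [Fintype W] {V : α → ι → ℝ} (hV : Measurable V) (w : α → W)
    (𝒱 : W → Submodule ℝ (ι → ℝ)) :
    ∃ c : ℝ≥0, ∀ q : ℕ, 0 < q → ∀ Γ : Set α,
      (∀ x ∈ Γ, ∀ x' ∈ Γ, w x = w x' → V x - V x' ∈ 𝒱 (w x)) →
      ∀ (κ : Measure α) [IsFiniteMeasure κ], (∀ᵐ x ∂κ, x ∈ Γ) →
        shannonEntropy (κ.map fun x j => quantize q (V x j)) ≤
          ∫⁻ x, ENNReal.ofReal (Module.finrank ℝ (𝒱 (w x)) * Real.log q +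
            ∑ j, (V x j ^ 2 + 2)) ∂κ + c := by
  classical
  choose T L hT hL using fun i => (𝒱 i).exists_finset_coord
  -- If the cells of two points agree on `T i`, their scaled `T i`-coordinates differ by at most 1,
  -- so any other scaled coordinate differs by at most the sum of the `|L i j t|`; taking floors
  -- costs at most 1 more.
  let b : W → ℕ := fun i => ⌈∑ j, ∑ t ∈ T i, |L i j t|⌉₊ + 1
  -- The constant does not depend on `q`, `Γ` or `κ`: later `Γ` runs over the fibres of the
  -- measurements and `κ` over the conditional laws.
  refine ⟨∑ i, ((2 * b i + 1) ^ Fintype.card ι : ℕ), fun q hq Γ hΓ κ _ hκ => ?_⟩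
  have hq' : (0 : ℝ) < q := by positivity
  set D : α → ι → ℝ := fun x j => quantize q (V x j)
  have hD : Measurable D := by
    refine measurable_pi_lambda _ fun j => (measurable_quantize q).comp ?_
    exact (measurable_pi_apply j).comp hV
  set γ := gaussianReal 0 1
  set Q : W → Set (ι → ℝ) := fun i => {v | ∃ x ∈ Γ, w x = i ∧ D x = v}
  -- Restricting the weights to the quantized values attained on the piece `i` of `Γ` is what bounds
  -- their total mass uniformly in `q`.
  set r : W → (ι → ℝ) → ℝ := fun i v =>
    (Q i).indicator (fun v => ∏ t ∈ T i, γ.real {u | quantize q u = v t}) v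
  have hpos : ∀ x, ∀ t, 0 < γ.real {u | quantize q u = D x t} := fun x t =>
    lt_of_lt_of_le (by positivity) (le_gaussianReal_quantize hq (V x t))
  have hrD : ∀ x ∈ Γ, r (w x) (D x) = ∏ t ∈ T (w x), γ.real {u | quantize q u = D x t} :=
    fun x hx => Set.indicator_of_mem (s := Q (w x)) ⟨x, hx, rfl, rfl⟩ _
  refine (shannonEntropy_map_le κ hD (countable_range_quantize_pi q V) w r ?_ ?_).trans
    (add_le_add ?_ ?_)
  · intro i v
    refine Set.indicator_nonneg (fun v _ => ?_) v
    exact Finset.prod_nonneg fun _ _ => measureReal_nonneg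
  · filter_upwards [hκ] with x hx
    rw [hrD x hx]
    exact Finset.prod_pos fun t _ => hpos x t
  · refine lintegral_mono_ae ?_
    filter_upwards [hκ] with x hx
    refine ENNReal.ofReal_le_ofReal ?_
    rw [hrD x hx, Real.log_prod fun t _ => (hpos x t).ne', ← Finset.sum_neg_distrib]
    calc ∑ t ∈ T (w x), -Real.log (γ.real {u | quantize q u = D x t})
        ≤ ∑ t ∈ T (w x), (Real.log q + (V x t ^ 2 + 2)) :=
          Finset.sum_le_sum fun t _ => neg_log_gaussianReal_quantize_le hq (V x t)
      _ ≤ _ := by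
          rw [Finset.sum_add_distrib, Finset.sum_const, hT, nsmul_eq_mul]
          exact add_le_add_right (Finset.sum_le_sum_of_subset_of_nonneg (Finset.subset_univ _)
            fun _ _ _ => by positivity) _
  · push_cast
    refine Finset.sum_le_sum fun i _ => ?_
    have h1 : ∀ v, ENNReal.ofReal (r i v) =
        (Q i).indicator (fun v => ∏ t ∈ T i, γ {u | quantize q u = v t}) v := fun v => by
      by_cases hv : v ∈ Q i
      · simp only [r, Set.indicator_of_mem hv]
        rw [ENNReal.ofReal_prod_of_nonneg fun _ _ => measureReal_nonneg]
        simp [ofReal_measureReal]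
      · simp [r, Set.indicator_of_notMem hv]
    simp_rw [h1]
    refine (tsum_prod_gaussianReal_le q (T i) (b i) (Q i) ?_).trans (by push_cast; exact le_rfl)
    rintro _ ⟨x, hx, rfl, rfl⟩ _ ⟨x', hx', hw, rfl⟩ hT j
    have hd : ∀ t ∈ T (w x), |(q : ℝ) * (V x t - V x' t)| ≤ 1 := fun t ht => by
      have := hT t ht
      simp only [D] at this
      rw [quantize_eq_iff hq] at this
      rw [mul_sub]
      exact (Int.abs_sub_lt_one_of_floor_eq_floor this).le
    refine ⟨⌊(q : ℝ) * V x j⌋ - ⌊(q : ℝ) * V x' j⌋, ?_, ?_⟩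
    · have hj := hL _ _ (hΓ x hx x' hx' hw.symm) j
      have h2 : |(q : ℝ) * V x j - q * V x' j| ≤ ∑ t ∈ T (w x), |L (w x) j t| := by
        rw [← mul_sub, ← Pi.sub_apply, hj, Finset.mul_sum]
        refine (Finset.abs_sum_le_sum_abs _ _).trans (Finset.sum_le_sum fun t ht => ?_)
        rw [mul_left_comm, abs_mul]
        exact mul_le_of_le_one_right (abs_nonneg _) (hd t ht)
      have h3 : ∑ t ∈ T (w x), |L (w x) j t| ≤ ⌈∑ j, ∑ t ∈ T (w x), |L (w x) j t|⌉₊ :=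
        (Finset.single_le_sum (f := fun j => ∑ t ∈ T (w x), |L (w x) j t|)
          (fun _ _ => Finset.sum_nonneg fun _ _ => abs_nonneg _) (Finset.mem_univ j)).trans
          (Nat.le_ceil _)
      have h4 := abs_le.1 (h2.trans h3)
      have e1 := Int.floor_le ((q : ℝ) * V x j)
      have e2 := Int.lt_floor_add_one ((q : ℝ) * V x j)
      have e3 := Int.floor_le ((q : ℝ) * V x' j)
      have e4 := Int.lt_floor_add_one ((q : ℝ) * V x' j)
      rw [← Int.cast_le (R := ℝ)]
      simp only [b]
      push_cast
      rw [abs_le]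
      constructor <;> linarith [h4.1, h4.2]
    · simp only [D, quantize]
      push_cast
      ring

/-! ### Passage to conditional laws. -/

theorem lintegral_lintegral_condDistrib {Ω α F : Type*} [MeasurableSpace Ω] [MeasurableSpace α]
    [StandardBorelSpace α] [Nonempty α] [MeasurableSpace F] (P : Measure Ω) [IsFiniteMeasure P]
    {U : Ω → α} (hU : Measurable U) {Y : Ω → F} (hY : Measurable Y) {f : α → ℝ≥0∞}
    (hf : Measurable f) :
    ∫⁻ y, ∫⁻ x, f x ∂(condDistrib U Y P y) ∂(P.map Y) = ∫⁻ ω, f (U ω) ∂P := by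
  rw [← lintegral_map hf hU, ← condDistrib_comp_map hY.aemeasurable hU.aemeasurable,
    Measure.lintegral_bind (Kernel.aemeasurable _) hf.aemeasurable]

theorem condShannonEntropy_comp {Ω α E F : Type*} [MeasurableSpace Ω] [MeasurableSpace α]
    [StandardBorelSpace α] [Nonempty α] [MeasurableSpace E] [StandardBorelSpace E] [Nonempty E]
    [MeasurableSpace F] (P : Measure Ω) [IsFiniteMeasure P] {U : Ω → α} (hU : Measurable U)
    (Y : Ω → F) {D : α → E} (hD : Measurable D) :
    condShannonEntropy P (fun ω => D (U ω)) Y =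
      ∫⁻ y, shannonEntropy ((condDistrib U Y P y).map D) ∂(P.map Y) := by
  refine lintegral_congr_ae ?_
  filter_upwards [condDistrib_comp (μ := P) Y hU.aemeasurable hD] with y hy
  change shannonEntropy (condDistrib (D ∘ U) Y P y) = _
  rw [hy, Kernel.map_apply _ hD]

/-- The conditional law of `Ψ(U)` given itself is a Dirac mass, and it is the image under `Ψ` of the
conditional law of `U`. -/
theorem ae_condDistrib_fiber {Ω α F : Type*} [MeasurableSpace Ω] [MeasurableSpace α]
    [StandardBorelSpace α] [Nonempty α] [MeasurableSpace F] [StandardBorelSpace F] [Nonempty F]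
    (P : Measure Ω) [IsFiniteMeasure P] {U : Ω → α} (hU : Measurable U) {Ψ : α → F}
    (hΨ : Measurable Ψ) :
    ∀ᵐ y ∂(P.map fun ω => Ψ (U ω)), ∀ᵐ x ∂(condDistrib U (fun ω => Ψ (U ω)) P y), Ψ x = y := by
  filter_upwards [condDistrib_comp (μ := P) (fun ω => Ψ (U ω)) hU.aemeasurable hΨ,
    condDistrib_self (μ := P) fun ω => Ψ (U ω)] with y h1 h2
  have h3 : (condDistrib U (fun ω => Ψ (U ω)) P y).map Ψ = Measure.dirac y := by
    rw [← Kernel.map_apply _ hΨ, ← h1]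
    exact h2.trans (Kernel.id_apply y)
  have h4 : ∀ᵐ z ∂((condDistrib U (fun ω => Ψ (U ω)) P y).map Ψ), z = y := by
    rw [h3]
    exact (ae_dirac_iff (measurableSet_singleton y)).2 rfl
  exact ae_of_ae_map hΨ.aemeasurable h4

/-- Apply the unconditional bound on each fibre of `Ψ` and average. The labels `w` are not observed,
but being finitely many they only affect the constant, which also absorbs the second moments. -/
theorem exists_condShannonEntropy_quantize_le {Ω α F ι W : Type*} [MeasurableSpace Ω]
    [MeasurableSpace α] [StandardBorelSpace α] [Nonempty α] [MeasurableSpace F]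
    [StandardBorelSpace F] [Nonempty F] [Fintype ι] [Fintype W] [MeasurableSpace W]
    [MeasurableSingletonClass W] (P : Measure Ω) [IsProbabilityMeasure P]
    {U : Ω → α} (hU : Measurable U) {Ψ : α → F} (hΨ : Measurable Ψ) {V : α → ι → ℝ}
    (hV : Measurable V) (hV2 : ∀ j, MemLp (fun ω => V (U ω) j) 2 P) {w : α → W}
    (hw : Measurable w) {𝒱 : W → Submodule ℝ (ι → ℝ)}
    (h𝒱 : ∀ x x', Ψ x = Ψ x' → w x = w x' → V x - V x' ∈ 𝒱 (w x)) :
    ∃ c : ℝ≥0, ∀ q : ℕ, 0 < q →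
      condShannonEntropy P (fun ω j => quantize q (V (U ω) j)) (fun ω => Ψ (U ω)) ≤
        (∫⁻ ω, (Module.finrank ℝ (𝒱 (w (U ω))) : ℝ≥0∞) ∂P) * ENNReal.ofReal (Real.log q) + c := by
  obtain ⟨c, hc⟩ := exists_shannonEntropy_map_quantize_le hV w 𝒱
  have hk : Measurable fun i => (Module.finrank ℝ (𝒱 i) : ℝ) := measurable_of_finite _
  have hVj : ∀ j, Measurable fun x => V x j := fun j => (measurable_pi_apply j).comp hV
  have hB : ∫⁻ ω, ENNReal.ofReal (∑ j, (V (U ω) j ^ 2 + 2)) ∂P ≠ ∞ := by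
    have : Integrable (fun ω => ∑ j, (V (U ω) j ^ 2 + 2)) P :=
      integrable_finsetSum _ fun j _ => (hV2 j).integrable_sq.add (integrable_const _)
    exact this.lintegral_lt_top.ne
  refine ⟨(∫⁻ ω, ENNReal.ofReal (∑ j, (V (U ω) j ^ 2 + 2)) ∂P).toNNReal + c, fun q hq => ?_⟩
  have hlog : 0 ≤ Real.log q := Real.log_natCast_nonneg q
  have hD : Measurable fun (x : α) (j : ι) => quantize q (V x j) :=
    measurable_pi_lambda _ fun j => (measurable_quantize q).comp (hVj j)
  rw [condShannonEntropy_comp P hU _ hD]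
  have hm : Measurable fun x => ENNReal.ofReal (Module.finrank ℝ (𝒱 (w x)) * Real.log q +
      ∑ j, (V x j ^ 2 + 2)) := by
    refine ENNReal.measurable_ofReal.comp (((hk.comp hw).mul_const _).add ?_)
    exact Finset.measurable_sum _ fun j _ => ((hVj j).pow_const 2).add_const _
  calc _ ≤ ∫⁻ y, (∫⁻ x, ENNReal.ofReal (Module.finrank ℝ (𝒱 (w x)) * Real.log q +
            ∑ j, (V x j ^ 2 + 2)) ∂(condDistrib U (fun ω => Ψ (U ω)) P y) + c)
            ∂(P.map fun ω => Ψ (U ω)) := by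
        refine lintegral_mono_ae ?_
        filter_upwards [ae_condDistrib_fiber P hU hΨ] with y hy
        exact hc q hq {x | Ψ x = y} (fun x hx x' hx' h => h𝒱 x x' (hx.trans hx'.symm) h) _ hy
    _ = ∫⁻ ω, ENNReal.ofReal (Module.finrank ℝ (𝒱 (w (U ω))) * Real.log q +
            ∑ j, (V (U ω) j ^ 2 + 2)) ∂P + c := by
        have : IsProbabilityMeasure (P.map fun ω => Ψ (U ω)) :=
          Measure.isProbabilityMeasure_map (hΨ.comp hU).aemeasurable
        have h := lintegral_lintegral_condDistrib P hU (Y := fun ω => Ψ (U ω)) (hΨ.comp hU) hm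
        rw [lintegral_add_right _ measurable_const, h, lintegral_const, measure_univ, mul_one]
    _ = _ := by
        have h1 : ∀ ω, ENNReal.ofReal (Module.finrank ℝ (𝒱 (w (U ω))) * Real.log q +
            ∑ j, (V (U ω) j ^ 2 + 2)) = (Module.finrank ℝ (𝒱 (w (U ω))) : ℝ≥0∞) *
              ENNReal.ofReal (Real.log q) + ENNReal.ofReal (∑ j, (V (U ω) j ^ 2 + 2)) := fun ω => by
          rw [ENNReal.ofReal_add (by positivity) (by positivity), ENNReal.ofReal_mul (by positivity),
            ENNReal.ofReal_natCast]
        simp_rw [h1]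
        have hk' : Measurable fun i => (Module.finrank ℝ (𝒱 i) : ℝ≥0∞) := measurable_of_finite _
        have hkU : Measurable fun ω => (Module.finrank ℝ (𝒱 (w (U ω))) : ℝ≥0∞) :=
          (hk'.comp hw).comp hU
        rw [lintegral_add_left (hkU.mul_const _), lintegral_mul_const _ hkU, ENNReal.coe_add,
          ENNReal.coe_toNNReal hB, add_assoc]

theorem tendsto_ofReal_log_atTop :
    Tendsto (fun q : ℕ => ENNReal.ofReal (Real.log q)) atTop (𝓝 ∞) :=
  ENNReal.tendsto_ofReal_atTop.comp (Real.tendsto_log_atTop.comp tendsto_natCast_atTop_atTop)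

theorem limsup_div_log_le {H : ℕ → ℝ≥0∞} {s : ℝ≥0∞} {c : ℝ≥0}
    (h : ∀ q : ℕ, 0 < q → H q ≤ s * ENNReal.ofReal (Real.log q) + c) :
    limsup (fun q : ℕ => H q / ENNReal.ofReal (Real.log q)) atTop ≤ s := by
  have hlim : Tendsto (fun q : ℕ => s + c / ENNReal.ofReal (Real.log q)) atTop (𝓝 s) := by
    have := (ENNReal.Tendsto.div (tendsto_const_nhds (x := (c : ℝ≥0∞)))
      (Or.inr ENNReal.top_ne_zero) tendsto_ofReal_log_atTop (Or.inr ENNReal.coe_ne_top))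
    simpa using (tendsto_const_nhds (x := s)).add this
  rw [← hlim.limsup_eq]
  refine limsup_le_limsup ?_
  filter_upwards [eventually_gt_atTop 1] with q hq
  have h1 : ENNReal.ofReal (Real.log q) ≠ 0 := by
    rw [Ne, ENNReal.ofReal_eq_zero, not_le]
    exact Real.log_pos (by exact_mod_cast hq)
  refine (ENNReal.div_le_div_right (h q (by omega)) _).trans ?_
  rw [ENNReal.add_div, ENNReal.mul_div_cancel_right h1 ENNReal.ofReal_ne_top]

/-! ### Upper bound on the conditional information dimension. -/

/-- The vectors supported on `C` and annihilated by `A`. -/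
def supportedKer {κ σ : Type*} (A : (κ → ℝ) →ₗ[ℝ] (σ → ℝ)) (C : Set κ) : Submodule ℝ (κ → ℝ) where
  carrier := {x | (∀ j ∉ C, x j = 0) ∧ A x = 0}
  add_mem' := fun ha hb => ⟨fun j hj => by simp [ha.1 j hj, hb.1 j hj], by simp [ha.2, hb.2]⟩
  zero_mem' := ⟨fun _ _ => rfl, map_zero A⟩
  smul_mem' := fun c x hx => ⟨fun j hj => by simp [hx.1 j hj], by simp [hx.2]⟩

/-- The finitely many values of `x` in `F`, with the other coordinates erased. -/
noncomputable def finsetPart {κ : Type*} (F : Finset ℝ) (x : κ → ℝ) (j : κ) : Option F :=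
  if h : x j ∈ F then some ⟨x j, h⟩ else none

theorem finsetPart_eq_none_iff {κ : Type*} {F : Finset ℝ} {x : κ → ℝ} {j : κ} :
    finsetPart F x j = none ↔ x j ∉ F := by
  unfold finsetPart
  split_ifs with h <;> simp [h]

theorem finsetPart_eq_some_iff {κ : Type*} {F : Finset ℝ} {x : κ → ℝ} {j : κ} {a : F} :
    finsetPart F x j = some a ↔ x j = a := by
  unfold finsetPart
  split_ifs with h
  · rw [Option.some_inj, Subtype.ext_iff]
  · simp only [false_iff]
    exact fun h' => h (h' ▸ a.2)

theorem eq_of_finsetPart_eq {κ : Type*} {F : Finset ℝ} {x x' : κ → ℝ}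
    (h : finsetPart F x = finsetPart F x') {j : κ} (hj : x j ∈ F) : x j = x' j := by
  have h1 : finsetPart F x j = some ⟨x j, hj⟩ := finsetPart_eq_some_iff.2 rfl
  rw [h] at h1
  exact (finsetPart_eq_some_iff.1 h1).symm

/-- Only finitely many labels are allowed in the entropy bound, so the countable set `D` is
exhausted by finite sets; continuity from above makes the error event negligible. -/
theorem exists_finset_measure_le {Ω κ : Type*} [MeasurableSpace Ω] [Finite κ] (P : Measure Ω)
    [IsFiniteMeasure P] {U : Ω → κ → ℝ} (hU : Measurable U) {D : Set ℝ} (hD : D.Countable) :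
    ∃ F : ℕ → Finset ℝ, (∀ n, (F n : Set ℝ) ⊆ D) ∧
      Tendsto (fun n => P {ω | ∃ j, U ω j ∈ D \ F n}) atTop (𝓝 0) := by
  classical
  -- The point 0 is inserted only so that an enumeration exists when `D` is empty; the filter in `F`
  -- removes it if it is not in `D`.
  obtain ⟨f, hf⟩ := (hD.insert 0).exists_eq_range (Set.insert_nonempty _ _)
  let F : ℕ → Finset ℝ := fun n => ((Finset.range n).image f).filter (· ∈ D)
  have hmono : Monotone F := fun m n hmn =>
    Finset.filter_subset_filter _ (Finset.image_subset_image (Finset.range_mono hmn))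
  refine ⟨F, fun n x hx => (Finset.mem_filter.1 hx).2, ?_⟩
  have hUj : ∀ j, Measurable fun ω => U ω j := fun j => (measurable_pi_apply j).comp hU
  have hempty : ⋂ n, {ω | ∃ j, U ω j ∈ D \ F n} = ∅ := by
    refine Set.eq_empty_of_forall_notMem fun ω hω => ?_
    have h : ∀ j, ∃ n, U ω j ∉ D \ F n := fun j => by
      by_cases hj : U ω j ∈ D
      · obtain ⟨n, hn⟩ : U ω j ∈ Set.range f := hf ▸ Set.mem_insert_of_mem _ hj
        refine ⟨n + 1, fun h => h.2 (Finset.mem_coe.2 (Finset.mem_filter.2 ⟨?_, hj⟩))⟩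
        exact Finset.mem_image.2 ⟨n, Finset.self_mem_range_succ n, hn⟩
      · exact ⟨0, fun h => hj h.1⟩
    choose n hn using h
    obtain ⟨M, hM⟩ := (Set.finite_range n).bddAbove
    obtain ⟨j, hj⟩ := Set.mem_iInter.1 hω M
    exact hn j ⟨hj.1, fun h => hj.2 (hmono (hM ⟨j, rfl⟩) h)⟩
  rw [← measure_empty (μ := P), ← hempty]
  refine tendsto_measure_iInter_atTop (fun n => ?_) (fun m n hmn ω hω => ?_)
    ⟨0, measure_ne_top _ _⟩
  · refine MeasurableSet.nullMeasurableSet ?_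
    have : {ω | ∃ j, U ω j ∈ D \ F n} = ⋃ j, (fun ω => U ω j) ⁻¹' (D \ F n) := by
      ext; simp
    rw [this]
    exact MeasurableSet.iUnion fun j => hUj j (hD.mono Set.sdiff_subset).measurableSet
  · obtain ⟨j, hj⟩ := hω
    exact ⟨j, hj.1, fun h => hj.2 (hmono hmn h)⟩

/-- The upper bound on conditional information dimension: given linear measurements `A U`, the
dimension of `B U` is at most the mean dimension of the image under `B` of the space of vectors
annihilated by `A` and supported on the coordinates where `U` avoids the countable set `D`. -/
theorem limsup_condShannonEntropy_div_log_le {Ω κ σ ι : Type*} [MeasurableSpace Ω] [Fintype κ]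
    [Fintype σ] [Fintype ι] (P : Measure Ω) [IsProbabilityMeasure P]
    {U : Ω → κ → ℝ} (hU : Measurable U) (hU2 : ∀ j, MemLp (fun ω => U ω j) 2 P)
    {D : Set ℝ} (hD : D.Countable)
    (A : (κ → ℝ) →ₗ[ℝ] (σ → ℝ)) (B : (κ → ℝ) →ₗ[ℝ] (ι → ℝ)) :
    limsup (fun q : ℕ => condShannonEntropy P (fun ω j => quantize q (B (U ω) j))
        (fun ω => A (U ω)) / ENNReal.ofReal (Real.log q)) atTop ≤
      ∫⁻ ω, (Module.finrank ℝ ((supportedKer A {j | U ω j ∉ D}).map B) : ℝ≥0∞) ∂P := by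
  classical
  obtain ⟨F, hFD, hF⟩ := exists_finset_measure_le P hU hD
  set s := ∫⁻ ω, (Module.finrank ℝ ((supportedKer A {j | U ω j ∉ D}).map B) : ℝ≥0∞) ∂P
  have hUj : ∀ j, Measurable fun ω => U ω j := fun j => (measurable_pi_apply j).comp hU
  have hA : Measurable A := A.continuous_of_finiteDimensional.measurable
  have hB : Measurable B := B.continuous_of_finiteDimensional.measurable
  have hB2 : ∀ j, MemLp (fun ω => B (U ω) j) 2 P := fun j => by
    have : (fun ω => B (U ω) j) = fun ω => ∑ k, U ω k * B (Pi.single k 1) j := by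
      ext ω
      rw [LinearMap.pi_apply_eq_sum_univ B (U ω), Finset.sum_apply]
      refine Finset.sum_congr rfl fun k _ => ?_
      rw [Pi.smul_apply, smul_eq_mul]
      have : (fun j => if k = j then (1 : ℝ) else 0) = Pi.single k 1 := by
        ext i
        simp [Pi.single_apply, eq_comm]
      rw [this]
    rw [this]
    exact memLp_finsetSum _ fun k _ => (hU2 k).mul_const _
  have hlim : Tendsto (fun n => s + Fintype.card ι * P {ω | ∃ j, U ω j ∈ D \ F n}) atTop
      (𝓝 s) := by
    have := (tendsto_const_nhds (x := s)).add (ENNReal.Tendsto.const_mul hF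
      (Or.inr (ENNReal.natCast_ne_top (Fintype.card ι))))
    simpa using this
  -- For fixed `n` the label records the exact values in `F n`, so points with equal labels and
  -- measurements differ by a vector of `supportedKer`. Unless some coordinate lies in `D \ F n`,
  -- the unlabelled coordinates are exactly those avoiding `D`; in the exceptional case the
  -- dimension is bounded by `card ι`.
  refine ge_of_tendsto' hlim fun n => ?_
  let _ : MeasurableSpace (Option (F n)) := ⊤
  have hw : Measurable (finsetPart (κ := κ) (F n)) := by
    refine measurable_pi_lambda _ fun j => measurable_to_countable' fun a => ?_
    rcases a with _ | a
    · have : (fun x : κ → ℝ => finsetPart (F n) x j) ⁻¹' {none} =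
          (fun x : κ → ℝ => x j) ⁻¹' (F n : Set ℝ)ᶜ := by
        ext x; simp [finsetPart_eq_none_iff]
      rw [this]
      exact measurable_pi_apply j (F n).measurableSet.compl
    · have : (fun x : κ → ℝ => finsetPart (F n) x j) ⁻¹' {some a} =
          (fun x : κ → ℝ => x j) ⁻¹' {(a : ℝ)} := by
        ext x; simp [finsetPart_eq_some_iff]
      rw [this]
      exact measurable_pi_apply j (measurableSet_singleton _)
  obtain ⟨c, hc⟩ := exists_condShannonEntropy_quantize_le P hU (Ψ := A) hA (V := B) hB hB2 hw
    (𝒱 := fun i => (supportedKer A {j | i j = none}).map B) (fun x x' hx hxx' => by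
      rw [← map_sub]
      refine Submodule.mem_map_of_mem ⟨fun j hj => ?_, by rw [map_sub, hx, sub_self]⟩
      rw [Set.mem_ofPred_eq, finsetPart_eq_none_iff, not_not] at hj
      rw [Pi.sub_apply, eq_of_finsetPart_eq hxx' hj, sub_self])
  refine (limsup_div_log_le hc).trans ?_
  have hS : MeasurableSet {ω | ∃ j, U ω j ∈ D \ F n} := by
    have : {ω | ∃ j, U ω j ∈ D \ F n} = ⋃ j, (fun ω => U ω j) ⁻¹' (D \ F n) := by
      ext; simp
    rw [this]
    exact MeasurableSet.iUnion fun j => hUj j (hD.mono Set.sdiff_subset).measurableSet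
  rw [← lintegral_indicator_const hS, ← lintegral_add_right _ (measurable_const.indicator hS)]
  refine lintegral_mono fun ω => ?_
  by_cases hω : ω ∈ {ω | ∃ j, U ω j ∈ D \ F n}
  · simp only [Set.indicator_of_mem hω]
    refine le_add_left ?_
    have := Submodule.finrank_le
      ((supportedKer A {j | finsetPart (F n) (U ω) j = none}).map B)
    rw [Module.finrank_fintype_fun_eq_card] at this
    exact_mod_cast this
  · have : {j | finsetPart (F n) (U ω) j = none} = {j | U ω j ∉ D} := by
      ext j
      simp only [Set.mem_ofPred_eq, finsetPart_eq_none_iff]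
      refine ⟨fun h h' => hω ⟨j, h', h⟩, fun h h' => h (hFD n h')⟩
    rw [Set.indicator_of_notMem hω, add_zero, this]

/-! ### Lower bound on the conditional information dimension. -/

/-- Almost everywhere on `T` the measure `κ` has a finite density `< m` with respect to Lebesgue
measure. The cell of `x` lies in the ball of radius `1 / q` about `x`, so its mass is eventually at
most `2m / q`, and its information at least `log q - log (2m)`. -/
theorem ae_one_le_liminf_information {κ : Measure ℝ} [IsFiniteMeasure κ] {T : Set ℝ}
    (hac : κ.restrict T ≪ volume) :
    ∀ᵐ x ∂κ, x ∈ T → 1 ≤ liminf (fun q : ℕ =>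
      ENNReal.ofReal (-Real.log ((κ.map (quantize q)).real {quantize q x})) /
        ENNReal.ofReal (Real.log q)) atTop := by
  have h1 : ∀ᵐ x, Tendsto (fun r => κ (Metric.closedBall x r) / volume (Metric.closedBall x r))
      (𝓝[>] 0) (𝓝 (κ.rnDeriv volume x)) := Besicovitch.ae_tendsto_rnDeriv κ volume
  have h2 := Measure.rnDeriv_lt_top κ (volume : Measure ℝ)
  have h3 : ∀ᵐ x ∂κ, ∀ q, 0 < (κ.map (quantize q)).real {quantize q x} :=
    ae_all_iff.2 fun q => ae_map_singleton_pos κ (measurable_quantize q)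
      (countable_range_quantize q)
  filter_upwards [ae_imp_of_ae_restrict (hac.ae_le (h1.and h2)), h3] with x hx hpos hxT
  obtain ⟨hx1, hx2⟩ := hx hxT
  obtain ⟨m, hm1, hm2⟩ := ENNReal.lt_iff_exists_nnreal_btwn.1 hx2
  have hm1' : (0 : ℝ) < m := by
    have : (0 : ℝ≥0∞) < m := zero_le.trans_lt hm1
    exact_mod_cast this
  have hseq : Tendsto (fun q : ℕ => 1 / (q : ℝ)) atTop (𝓝[>] 0) := by
    refine tendsto_nhdsWithin_iff.2 ⟨tendsto_one_div_atTop_nhds_zero_nat, ?_⟩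
    filter_upwards [eventually_gt_atTop 0] with q hq
    have : (0 : ℝ) < q := by positivity
    exact Set.mem_Ioi.2 (by positivity)
  have hev := (hx1.comp hseq).eventually_lt_const hm1
  have hlim : Tendsto (fun q : ℕ => ENNReal.ofReal (1 - Real.log (2 * m) / Real.log q)) atTop
      (𝓝 1) := by
    have : Tendsto (fun q : ℕ => 1 - Real.log (2 * m) / Real.log q) atTop (𝓝 (1 - 0)) :=
      tendsto_const_nhds.sub (tendsto_const_nhds.div_atTop
        (Real.tendsto_log_atTop.comp tendsto_natCast_atTop_atTop))
    rw [sub_zero] at this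
    simpa using ENNReal.tendsto_ofReal this
  rw [← hlim.liminf_eq]
  refine liminf_le_liminf ?_
  filter_upwards [hev, eventually_gt_atTop 1] with q hq hq1
  have hq0 : (0 : ℝ) < q := by positivity
  have hlog : 0 < Real.log q := Real.log_pos (by exact_mod_cast hq1)
  have hcell : (κ.map (quantize q)).real {quantize q x} ≤ 2 * m / q := by
    rw [map_measureReal_apply (measurable_quantize q) (measurableSet_singleton _)]
    refine ENNReal.toReal_le_of_le_ofReal (by positivity) ?_
    have hsub : quantize q ⁻¹' {quantize q x} ⊆ Metric.closedBall x (1 / q) := by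
      intro u hu
      have e1 := quantize_le (q := q) (by omega) x
      have e2 := lt_quantize_add (q := q) (by omega) x
      have e3 : u ∈ Set.Ico (quantize q x) (quantize q x + 1 / q) := by
        rw [← setOf_quantize_eq (by omega)]; exact hu
      rw [Metric.mem_closedBall, Real.dist_eq, abs_le]
      constructor <;> linarith [e3.1, e3.2]
    refine (measure_mono hsub).trans ?_
    have h4 : κ (Metric.closedBall x (1 / q)) / volume (Metric.closedBall x (1 / (q : ℝ))) ≤ m :=
      hq.le
    rw [Real.volume_closedBall, ENNReal.div_le_iff (by simp [hq0]) ENNReal.ofReal_ne_top] at h4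
    refine h4.trans (le_of_eq ?_)
    rw [← ENNReal.ofReal_coe_nnreal, ← ENNReal.ofReal_mul hm1'.le]
    congr 1
    ring
  rw [← ENNReal.ofReal_div_of_pos hlog]
  refine ENNReal.ofReal_le_ofReal ?_
  rw [le_div_iff₀ hlog, sub_mul, one_mul, div_mul_cancel₀ _ hlog.ne']
  have := Real.log_le_log (hpos q) hcell
  rw [Real.log_div (by positivity) hq0.ne'] at this
  linarith

/-- The mass of an absolutely continuous part bounds the information dimension from below. -/
theorem le_liminf_shannonEntropy_div_log {κ : Measure ℝ} [IsFiniteMeasure κ] {T : Set ℝ}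
    (hT : MeasurableSet T) (hac : κ.restrict T ≪ volume) :
    κ T ≤ liminf (fun q : ℕ => shannonEntropy (κ.map (quantize q)) /
      ENNReal.ofReal (Real.log q)) atTop := by
  have hm : ∀ q : ℕ, Measurable fun x =>
      ENNReal.ofReal (-Real.log ((κ.map (quantize q)).real {quantize q x})) /
        ENNReal.ofReal (Real.log q) := fun q =>
    (measurable_comp_of_countable_range (measurable_quantize q) (countable_range_quantize q)
      fun v => ENNReal.ofReal (-Real.log ((κ.map (quantize q)).real {v}))).div_const _
  calc κ T = ∫⁻ x, T.indicator 1 x ∂κ := (lintegral_indicator_one hT).symm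
    _ ≤ ∫⁻ x, liminf (fun q : ℕ =>
          ENNReal.ofReal (-Real.log ((κ.map (quantize q)).real {quantize q x})) /
            ENNReal.ofReal (Real.log q)) atTop ∂κ := by
        refine lintegral_mono_ae ?_
        filter_upwards [ae_one_le_liminf_information hac] with x hx
        by_cases hxT : x ∈ T
        · simpa [hxT] using hx hxT
        · simp [hxT]
    _ ≤ _ := lintegral_liminf_le hm
    _ = _ := by
        congr 1
        ext q
        simp_rw [div_eq_mul_inv]
        rw [lintegral_mul_const _ (measurable_comp_of_countable_range (measurable_quantize q)
            (countable_range_quantize q)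
            fun v => ENNReal.ofReal (-Real.log ((κ.map (quantize q)).real {v}))),
          shannonEntropy_map_eq_lintegral κ (measurable_quantize q) (countable_range_quantize q)]

theorem measurable_shannonEntropy_map {α F E : Type*} [MeasurableSpace α] [MeasurableSpace F]
    [MeasurableSpace E] [MeasurableSingletonClass E] (κ : Kernel F α) {D : α → E}
    (hD : Measurable D) (hK : (Set.range D).Countable) :
    Measurable fun y => shannonEntropy ((κ y).map D) := by
  have h : ∀ y, shannonEntropy ((κ y).map D) = ∑' v : Set.range D,
      ENNReal.ofReal (Real.negMulLog (κ y (D ⁻¹' {v.1})).toReal) := fun y => by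
    have hv : ∀ v, ((κ y).map D).real {v} = (κ y (D ⁻¹' {v})).toReal := fun v => by
      rw [measureReal_def, Measure.map_apply hD (measurableSet_singleton v)]
    simp only [shannonEntropy, hv]
    refine (tsum_subtype_eq_of_support_subset (f := fun v =>
      ENNReal.ofReal (Real.negMulLog (κ y (D ⁻¹' {v})).toReal)) fun v hv' => ?_).symm
    by_contra hvK
    have : D ⁻¹' {v} = ∅ := by
      ext x
      simp only [Set.mem_preimage, Set.mem_singleton_iff, Set.mem_empty_iff_false, iff_false]
      rintro rfl
      exact hvK ⟨x, rfl⟩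
    exact hv' (by simp [this])
  simp_rw [h]
  have : Countable (Set.range D) := hK.to_subtype
  refine Measurable.tsum fun v => ENNReal.measurable_ofReal.comp ?_
  exact Real.continuous_negMulLog.measurable.comp
    (κ.measurable_coe (hD (measurableSet_singleton _))).ennreal_toReal

/-- If, on the event `E`, the pair `(Y, Z)` almost surely avoids every measurable set with null
sections, the conditional information dimension of `Z` given `Y` is at least `P E`. -/
theorem le_liminf_condShannonEntropy_div_log {Ω F : Type*} [MeasurableSpace Ω]
    [MeasurableSpace F] (P : Measure Ω) [IsFiniteMeasure P] {Y : Ω → F}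
    (hY : Measurable Y) {Z : Ω → ℝ} (hZ : Measurable Z) {E : Set Ω}
    (hE : ∀ G : Set (F × ℝ), MeasurableSet G → (∀ y, volume {z | (y, z) ∈ G} = 0) →
      P (E ∩ {ω | (Y ω, Z ω) ∈ G}) = 0) :
    P E ≤ liminf (fun q : ℕ => condShannonEntropy P (fun ω => quantize q (Z ω)) Y /
      ENNReal.ofReal (Real.log q)) atTop := by
  set κ := condDistrib Z Y P
  set η : Kernel F ℝ := Kernel.const F (gaussianReal 0 1)
  -- The Gaussian replaces Lebesgue measure by an equivalent finite one. The sections of `G` are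
  -- null and carry the singular part of the conditional law; the hypothesis on `E` says that this
  -- part does not meet `E`.
  set G := Kernel.mutuallySingularSet κ η
  have hG : MeasurableSet G := Kernel.measurableSet_mutuallySingularSet κ η
  have hG0 : ∀ y, volume {z | (y, z) ∈ G} = 0 := fun y =>
    gaussianReal_absolutelyContinuous' 0 one_ne_zero
      (Kernel.measure_mutuallySingularSetSlice κ η y)
  have hac : ∀ y, (κ y).restrict {z | (y, z) ∈ Gᶜ} ≪ volume := fun y => by
    have hs : MeasurableSet {z | (y, z) ∈ Gᶜ} := measurable_prodMk_left hG.compl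
    refine Measure.AbsolutelyContinuous.mk fun s hsm hs0 => ?_
    have hsing : κ.singularPart η y (s ∩ {z | (y, z) ∈ Gᶜ}) = 0 :=
      Kernel.singularPart_of_subset_compl_mutuallySingularSetSlice Set.inter_subset_right
    rw [Measure.restrict_apply hsm, ← Kernel.rnDeriv_add_singularPart κ η, add_apply,
      Measure.add_apply, hsing, add_zero]
    refine (Kernel.withDensity_absolutelyContinuous (κ := η) (κ.rnDeriv η) y) ?_
    exact measure_mono_null Set.inter_subset_left
      (gaussianReal_absolutelyContinuous 0 one_ne_zero hs0)
  calc P E ≤ P (E ∩ {ω | (Y ω, Z ω) ∈ G}) + P {ω | (Y ω, Z ω) ∈ Gᶜ} := by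
        refine (measure_mono fun ω hω => ?_).trans (measure_union_le _ _)
        by_cases h : (Y ω, Z ω) ∈ G
        · exact Or.inl ⟨hω, h⟩
        · exact Or.inr h
    _ = P.map (fun ω => (Y ω, Z ω)) Gᶜ := by
        rw [hE G hG hG0, zero_add, Measure.map_apply (hY.prodMk hZ) hG.compl]
        rfl
    _ = ∫⁻ y, κ y {z | (y, z) ∈ Gᶜ} ∂(P.map Y) := by
        rw [← compProd_map_condDistrib hZ.aemeasurable, Measure.compProd_apply hG.compl]
        rfl
    _ ≤ ∫⁻ y, liminf (fun q : ℕ => shannonEntropy ((κ y).map (quantize q)) /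
          ENNReal.ofReal (Real.log q)) atTop ∂(P.map Y) :=
        lintegral_mono fun y => le_liminf_shannonEntropy_div_log
          (measurable_prodMk_left hG.compl) (hac y)
    _ ≤ _ := lintegral_liminf_le fun q => (measurable_shannonEntropy_map κ
        (measurable_quantize q) (countable_range_quantize q)).div_const _
    _ = _ := by
        congr 1
        ext q
        simp_rw [div_eq_mul_inv]
        rw [lintegral_mul_const _ (measurable_shannonEntropy_map κ
          (measurable_quantize q) (countable_range_quantize q)),
          condShannonEntropy_comp P hZ Y (measurable_quantize q)]

/-! ### Avoidance of null sections by translation. -/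

theorem Measure.pi_absolutelyContinuous : ∀ {n : ℕ} {μ ν : Fin n → Measure ℝ}
    [∀ i, SigmaFinite (μ i)] [∀ i, SigmaFinite (ν i)], (∀ i, μ i ≪ ν i) →
      Measure.pi μ ≪ Measure.pi ν
  | 0, μ, ν, _, _, _ => by rw [Measure.pi_of_empty μ, Measure.pi_of_empty ν]
  | n + 1, μ, ν, _, _, h => by
    have e1 := (measurePreserving_piFinSuccAbove μ 0).symm
    have e2 := (measurePreserving_piFinSuccAbove ν 0).symm
    rw [← e1.map_eq, ← e2.map_eq]
    exact ((h 0).prod (Measure.pi_absolutelyContinuous fun j => h _)).map e1.measurable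

/-- Fix the pattern `C` of coordinates avoiding `D`, and take `w` supported on `C` with `A w = 0`
and `ℓ w = 1`. Moving along `w` fixes `A` and shifts `ℓ`, so every line in this direction meets the
bad set `S` in a null set. The dominating product measure is invariant under these translations, so
Fubini gives the measure of `S` times the infinite length of the line as 0. -/
theorem measure_supportedKer_inter_eq_zero {Ω σ : Type*} [MeasurableSpace Ω] [Finite σ] {N : ℕ}
    (P : Measure Ω) {U : Ω → Fin N → ℝ} (hU : Measurable U) {μ : Measure ℝ}
    [IsProbabilityMeasure μ] (hlaw : P.map U = Measure.pi fun _ => μ) {D : Set ℝ}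
    (hD : MeasurableSet D) (hμ : μ.restrict Dᶜ ≪ volume)
    (A : (Fin N → ℝ) →ₗ[ℝ] (σ → ℝ)) (ℓ : (Fin N → ℝ) →ₗ[ℝ] ℝ) {G : Set ((σ → ℝ) × ℝ)}
    (hG : MeasurableSet G) (hG0 : ∀ y, volume {z | (y, z) ∈ G} = 0) :
    P ({ω | ∃ x ∈ supportedKer A {j | U ω j ∉ D}, ℓ x ≠ 0} ∩
      {ω | (A (U ω), ℓ (U ω)) ∈ G}) = 0 := by
  classical
  have hA : Measurable A := A.continuous_of_finiteDimensional.measurable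
  have hℓ : Measurable ℓ := ℓ.continuous_of_finiteDimensional.measurable
  set S : Set (Fin N → ℝ) := {x | (A x, ℓ x) ∈ G}
  have hS : MeasurableSet S := (hA.prodMk hℓ) hG
  let box : Set (Fin N) → Fin N → Set ℝ := fun C j => if j ∈ C then Dᶜ else D
  have hbox : ∀ C j, MeasurableSet (box C j) := fun C j => by
    simp only [box]; split_ifs
    exacts [hD.compl, hD]
  have hnull : ∀ C : Set (Fin N), (∃ x ∈ supportedKer A C, ℓ x ≠ 0) →
      P (U ⁻¹' (S ∩ Set.univ.pi (box C))) = 0 := by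
    rintro C ⟨w', hw', hw0⟩
    obtain ⟨w, hw, hw1⟩ : ∃ w ∈ supportedKer A C, ℓ w = 1 :=
      ⟨(ℓ w')⁻¹ • w', Submodule.smul_mem _ _ hw', by simp [hw0]⟩
    rw [← Measure.map_apply hU (hS.inter (MeasurableSet.univ_pi (hbox C))), hlaw,
      ← Measure.restrict_apply hS, Measure.restrict_pi_pi]
    -- Lebesgue measure on the coordinates in `C` makes translations along `w` measure preserving;
    -- the other coordinates do not move.
    set ν : Fin N → Measure ℝ := fun j => if j ∈ C then volume else μ.restrict D
    have hν : ∀ j, SigmaFinite (ν j) := fun j => by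
      simp only [ν]; split_ifs <;> infer_instance
    refine Measure.pi_absolutelyContinuous (ν := ν) (fun j => ?_) ?_
    · by_cases hj : j ∈ C
      · simpa [ν, box, hj] using hμ
      · simpa [ν, box, hj] using Measure.AbsolutelyContinuous.rfl
    have hpres : ∀ t : ℝ, MeasurePreserving (fun (x : Fin N → ℝ) j => x j + t * w j)
        (Measure.pi ν) (Measure.pi ν) := fun t => by
      refine measurePreserving_pi ν ν (f := fun j y => y + t * w j) fun j => ?_
      by_cases hj : j ∈ C
      · simpa [ν, hj] using measurePreserving_add_right volume (t * w j)
      · simp only [hw.1 j hj, mul_zero, add_zero]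
        exact MeasurePreserving.id (ν j)
    set T : Set ((Fin N → ℝ) × ℝ) := {p | (fun j => p.1 j + p.2 * w j) ∈ S}
    have hT : MeasurableSet T := by
      have : Measurable fun p : (Fin N → ℝ) × ℝ => fun j => p.1 j + p.2 * w j :=
        measurable_pi_lambda _ fun j =>
          ((measurable_pi_apply j).comp measurable_fst).add (measurable_snd.mul_const _)
      exact this hS
    have hT0 : ((Measure.pi ν).prod volume) T = 0 := by
      rw [Measure.measure_prod_null hT]
      refine Eventually.of_forall fun x => ?_
      have : Prod.mk x ⁻¹' T = (fun t => ℓ x + t) ⁻¹' {z | (A x, z) ∈ G} := by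
        ext t
        have hx : (fun j => x j + t * w j) = x + t • w := rfl
        simp only [T, S, Set.mem_preimage, Set.mem_ofPred_eq, hx, map_add, map_smul, hw.2, hw1,
          smul_zero, add_zero, smul_eq_mul, mul_one]
      change volume (Prod.mk x ⁻¹' T) = 0
      rw [this, measure_preimage_add, hG0]
    rw [Measure.prod_apply_symm hT] at hT0
    have h1 : ∀ t : ℝ, Measure.pi ν ((fun x => (x, t)) ⁻¹' T) = Measure.pi ν S := fun t =>
      (hpres t).measure_preimage hS.nullMeasurableSet
    simp_rw [h1, lintegral_const] at hT0
    simpa using hT0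
  have hcover : {ω | ∃ x ∈ supportedKer A {j | U ω j ∉ D}, ℓ x ≠ 0} ∩
      {ω | (A (U ω), ℓ (U ω)) ∈ G} ⊆
      ⋃ C : {C : Set (Fin N) // ∃ x ∈ supportedKer A C, ℓ x ≠ 0},
        U ⁻¹' (S ∩ Set.univ.pi (box C)) := by
    rintro ω ⟨h1, h2⟩
    refine Set.mem_iUnion.2 ⟨⟨{j | U ω j ∉ D}, h1⟩, h2, fun j _ => ?_⟩
    by_cases hj : U ω j ∈ D <;> simp [box, hj]
  exact measure_mono_null hcover (measure_iUnion_null fun C => hnull C C.2)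

/-! ### The Hadamard matrix and its free rows. -/

/-- The block recursion peels off the highest bit of the indices. The product formula treats all
bits alike, so the lowest bit can be peeled off instead; that recursion respects the order of the
rows. -/
theorem hadamardMatrix_apply : ∀ (n : ℕ) (i j : Fin (2 ^ n)), hadamardMatrix n i j =
    ∏ k ∈ Finset.range n, if (i : ℕ).testBit k ∧ (j : ℕ).testBit k then (-1 : ℝ) else 1
  | 0, i, j => by simp [hadamardMatrix]
  | n + 1, i, j => by
    let e : Fin (2 ^ n) ⊕ Fin (2 ^ n) ≃ Fin (2 ^ (n + 1)) :=
      finSumFinEquiv.trans (finCongr (by rw [pow_succ, mul_two]))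
    have hl : ∀ a, ((e (Sum.inl a) : Fin (2 ^ (n + 1))) : ℕ) = a := fun a => by simp [e]
    have hr : ∀ a, ((e (Sum.inr a) : Fin (2 ^ (n + 1))) : ℕ) = 2 ^ n + a := fun a => by
      simp [e, add_comm]
    have hH : ∀ a b, hadamardMatrix (n + 1) (e a) (e b) = Matrix.fromBlocks (hadamardMatrix n)
        (hadamardMatrix n) (hadamardMatrix n) (-hadamardMatrix n) a b := fun a b => by
      change Matrix.reindex e e _ (e a) (e b) = _
      simp
    have hn : ∀ a : Fin (2 ^ n), (a : ℕ).testBit n = false := fun a =>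
      Nat.testBit_lt_two_pow a.2
    have hlt : ∀ (a : Fin (2 ^ n)), ∀ k ∈ Finset.range n,
        (2 ^ n + (a : ℕ)).testBit k = (a : ℕ).testBit k := fun a k hk =>
      Nat.testBit_two_pow_add_gt (Finset.mem_range.1 hk) _
    obtain ⟨a, rfl⟩ := e.surjective i
    obtain ⟨b, rfl⟩ := e.surjective j
    rw [hH, Finset.prod_range_succ]
    rcases a with a | a <;> rcases b with b | b
    · simp [hl, hn, hadamardMatrix_apply n a b]
    · simp only [hl, hr, hn, Matrix.fromBlocks_apply₁₂, hadamardMatrix_apply n a b]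
      simp only [Bool.false_eq_true, false_and, if_false, mul_one]
      exact Finset.prod_congr rfl fun k hk => by rw [hlt b k hk]
    · simp only [hl, hr, hn, Matrix.fromBlocks_apply₂₁, hadamardMatrix_apply n a b]
      simp only [Bool.false_eq_true, and_false, if_false, mul_one]
      exact Finset.prod_congr rfl fun k hk => by rw [hlt a k hk]
    · simp only [hr, Matrix.fromBlocks_apply₂₂, Matrix.neg_apply, hadamardMatrix_apply n a b,
        Nat.testBit_two_pow_add_eq, hn]
      simp only [Bool.not_false, and_self, if_true, mul_neg, mul_one, neg_inj]
      exact Finset.prod_congr rfl fun k hk => by rw [hlt a k hk, hlt b k hk]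

/-- The even and odd indices. -/
def evenOddEquiv (n : ℕ) : Fin (2 ^ n) ⊕ Fin (2 ^ n) ≃ Fin (2 ^ (n + 1)) where
  toFun := Sum.elim (fun i => ⟨2 * i, by rw [pow_succ]; omega⟩)
    fun i => ⟨2 * i + 1, by rw [pow_succ]; omega⟩
  invFun i := if (i : ℕ) % 2 = 0 then Sum.inl ⟨i / 2, by have := i.2; have := pow_succ 2 n; omega⟩
    else Sum.inr ⟨i / 2, by have := i.2; have := pow_succ 2 n; omega⟩
  left_inv := by
    rintro (i | i)
    · simp
    · have h1 : (2 * (i : ℕ) + 1) % 2 ≠ 0 := by omega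
      have h2 : (2 * (i : ℕ) + 1) / 2 = i := by omega
      simp [h2]
  right_inv := by
    intro i
    by_cases h : (i : ℕ) % 2 = 0
    · simp only [h, if_true, Sum.elim_inl, Fin.ext_iff]; omega
    · simp only [h, if_false, Sum.elim_inr, Fin.ext_iff]; omega

@[simp] theorem evenOddEquiv_inl {n : ℕ} (i : Fin (2 ^ n)) :
    (evenOddEquiv n (Sum.inl i) : ℕ) = 2 * i := rfl

@[simp] theorem evenOddEquiv_inr {n : ℕ} (i : Fin (2 ^ n)) :
    (evenOddEquiv n (Sum.inr i) : ℕ) = 2 * i + 1 := rfl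

theorem hadamardMatrix_evenOdd (n : ℕ) (a b : Fin (2 ^ n) ⊕ Fin (2 ^ n)) :
    hadamardMatrix (n + 1) (evenOddEquiv n a) (evenOddEquiv n b) =
      Matrix.fromBlocks (hadamardMatrix n) (hadamardMatrix n) (hadamardMatrix n)
        (-hadamardMatrix n) a b := by
  have h1 : ∀ i : ℕ, (2 * i + 1) / 2 = i := fun i => by omega
  rw [hadamardMatrix_apply, Finset.prod_range_succ']
  rcases a with a | a <;> rcases b with b | b <;>
    simp [Nat.testBit_succ, h1, hadamardMatrix_apply]

theorem hadamardMatrix_mulVec_even (n : ℕ) (x : Fin (2 ^ (n + 1)) → ℝ) (i : Fin (2 ^ n)) :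
    (hadamardMatrix (n + 1) *ᵥ x) (evenOddEquiv n (Sum.inl i)) =
      (hadamardMatrix n *ᵥ fun j => x (evenOddEquiv n (Sum.inl j))) i +
      (hadamardMatrix n *ᵥ fun j => x (evenOddEquiv n (Sum.inr j))) i := by
  simp only [Matrix.mulVec, dotProduct]
  rw [← (evenOddEquiv n).sum_comp, Fintype.sum_sum_type]
  simp [hadamardMatrix_evenOdd]

theorem hadamardMatrix_mulVec_odd (n : ℕ) (x : Fin (2 ^ (n + 1)) → ℝ) (i : Fin (2 ^ n)) :
    (hadamardMatrix (n + 1) *ᵥ x) (evenOddEquiv n (Sum.inr i)) =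
      (hadamardMatrix n *ᵥ fun j => x (evenOddEquiv n (Sum.inl j))) i -
      (hadamardMatrix n *ᵥ fun j => x (evenOddEquiv n (Sum.inr j))) i := by
  simp only [Matrix.mulVec, dotProduct]
  rw [← (evenOddEquiv n).sum_comp, Fintype.sum_sum_type]
  simp [hadamardMatrix_evenOdd, sub_eq_add_neg]

theorem hadamardMatrix_mulVec_injective : ∀ (n : ℕ) (x : Fin (2 ^ n) → ℝ),
    hadamardMatrix n *ᵥ x = 0 → x = 0
  | 0, x, h => by
    ext i
    have := congrFun h i
    have hi : ∀ j : Fin (2 ^ 0), j = i := fun j => Subsingleton.elim (α := Fin 1) j i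
    simpa [Matrix.mulVec, dotProduct, hadamardMatrix, hi default] using this
  | n + 1, x, h => by
    have h1 := fun i => hadamardMatrix_mulVec_even n x i
    have h2 := fun i => hadamardMatrix_mulVec_odd n x i
    simp only [h, Pi.zero_apply] at h1 h2
    have he := hadamardMatrix_mulVec_injective n (fun j => x (evenOddEquiv n (Sum.inl j)))
      (funext fun i => by rw [Pi.zero_apply]; linarith [h1 i, h2 i])
    have ho := hadamardMatrix_mulVec_injective n (fun j => x (evenOddEquiv n (Sum.inr j)))
      (funext fun i => by rw [Pi.zero_apply]; linarith [h1 i, h2 i])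
    ext i
    obtain ⟨a | a, rfl⟩ := (evenOddEquiv n).surjective i
    · exact congrFun he a
    · exact congrFun ho a

/-- Row `i` of the Hadamard matrix, restricted to the columns in `C`, is not in the span of the
rows above it. -/
def HadamardRowFree (n : ℕ) (i : Fin (2 ^ n)) (C : Set (Fin (2 ^ n))) : Prop :=
  ∃ x : Fin (2 ^ n) → ℝ, (∀ j ∉ C, x j = 0) ∧ (∀ k < i, (hadamardMatrix n *ᵥ x) k = 0) ∧
    (hadamardMatrix n *ᵥ x) i ≠ 0

/-- Interleave two vectors. -/
def interleave {n : ℕ} (a b : Fin (2 ^ n) → ℝ) (j : Fin (2 ^ (n + 1))) : ℝ :=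
  Sum.elim a b ((evenOddEquiv n).symm j)

@[simp] theorem interleave_inl {n : ℕ} (a b : Fin (2 ^ n) → ℝ) (j : Fin (2 ^ n)) :
    interleave a b (evenOddEquiv n (Sum.inl j)) = a j := by simp [interleave]

@[simp] theorem interleave_inr {n : ℕ} (a b : Fin (2 ^ n) → ℝ) (j : Fin (2 ^ n)) :
    interleave a b (evenOddEquiv n (Sum.inr j)) = b j := by simp [interleave]

theorem interleave_eq_zero {n : ℕ} {a b : Fin (2 ^ n) → ℝ} {C : Set (Fin (2 ^ (n + 1)))}
    (ha : ∀ j ∉ {j | evenOddEquiv n (Sum.inl j) ∈ C}, a j = 0)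
    (hb : ∀ j ∉ {j | evenOddEquiv n (Sum.inr j) ∈ C}, b j = 0) :
    ∀ j ∉ C, interleave a b j = 0 := by
  intro j hj
  obtain ⟨k | k, rfl⟩ := (evenOddEquiv n).surjective j
  · rw [interleave_inl]; exact ha k hj
  · rw [interleave_inr]; exact hb k hj

theorem hadamardMatrix_mulVec_interleave_eq_zero {n : ℕ} {a b : Fin (2 ^ n) → ℝ} {i : Fin (2 ^ n)}
    (ha : ∀ k < i, (hadamardMatrix n *ᵥ a) k = 0) (hb : ∀ k < i, (hadamardMatrix n *ᵥ b) k = 0)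
    {k : Fin (2 ^ (n + 1))} (hk : k < evenOddEquiv n (Sum.inl i)) :
    (hadamardMatrix (n + 1) *ᵥ interleave a b) k = 0 := by
  rw [Fin.lt_def] at hk
  obtain ⟨k | k, rfl⟩ := (evenOddEquiv n).surjective k
  · have hki : k < i := by rw [Fin.lt_def]; simp at hk; omega
    simp [hadamardMatrix_mulVec_even, ha k hki, hb k hki]
  · have hki : k < i := by rw [Fin.lt_def]; simp at hk; omega
    simp [hadamardMatrix_mulVec_odd, ha k hki, hb k hki]

/-- The rows before `2i` come in pairs `2k`, `2k+1` with `k < i`, giving the sum and the difference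
of the two half-size measurements at `k`. -/
theorem hadamardMatrix_mulVec_halves_eq_zero {n : ℕ} {x : Fin (2 ^ (n + 1)) → ℝ}
    {i : Fin (2 ^ n)}
    (hx : ∀ k < evenOddEquiv n (Sum.inl i), (hadamardMatrix (n + 1) *ᵥ x) k = 0) :
    (∀ k < i, (hadamardMatrix n *ᵥ fun j => x (evenOddEquiv n (Sum.inl j))) k = 0) ∧
    (∀ k < i, (hadamardMatrix n *ᵥ fun j => x (evenOddEquiv n (Sum.inr j))) k = 0) := by
  rw [← forall₂_and]
  intro k hk
  rw [Fin.lt_def] at hk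
  have h1 := hx (evenOddEquiv n (Sum.inl k)) (by rw [Fin.lt_def]; simp; omega)
  have h2 := hx (evenOddEquiv n (Sum.inr k)) (by rw [Fin.lt_def]; simp; omega)
  rw [hadamardMatrix_mulVec_even] at h1
  rw [hadamardMatrix_mulVec_odd] at h2
  constructor <;> linarith

/-- Row `2i` adds the values of the two halves at row `i`; a nonzero sum has a nonzero term, and
conversely a witness on one half is extended by zero. -/
theorem hadamardRowFree_even {n : ℕ} {i : Fin (2 ^ n)} {C : Set (Fin (2 ^ (n + 1)))} :
    HadamardRowFree (n + 1) (evenOddEquiv n (Sum.inl i)) C ↔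
      HadamardRowFree n i {j | evenOddEquiv n (Sum.inl j) ∈ C} ∨
      HadamardRowFree n i {j | evenOddEquiv n (Sum.inr j) ∈ C} := by
  constructor
  · rintro ⟨x, hxC, hx0, hxi⟩
    obtain ⟨h1, h2⟩ := hadamardMatrix_mulVec_halves_eq_zero hx0
    rw [hadamardMatrix_mulVec_even] at hxi
    by_cases ha : (hadamardMatrix n *ᵥ fun j => x (evenOddEquiv n (Sum.inl j))) i = 0
    · rw [ha, zero_add] at hxi
      exact Or.inr ⟨_, fun j hj => hxC _ hj, h2, hxi⟩
    · exact Or.inl ⟨_, fun j hj => hxC _ hj, h1, ha⟩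
  · rintro (⟨a, haC, ha0, hai⟩ | ⟨b, hbC, hb0, hbi⟩)
    · refine ⟨interleave a 0, interleave_eq_zero haC fun _ _ => rfl, fun k hk =>
        hadamardMatrix_mulVec_interleave_eq_zero ha0 (fun _ _ => by simp) hk, ?_⟩
      rw [hadamardMatrix_mulVec_even]
      simpa [← Pi.zero_def] using hai
    · refine ⟨interleave 0 b, interleave_eq_zero (fun _ _ => rfl) hbC, fun k hk =>
        hadamardMatrix_mulVec_interleave_eq_zero (fun _ _ => by simp) hb0 hk, ?_⟩
      rw [hadamardMatrix_mulVec_even]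
      simpa [← Pi.zero_def] using hbi

/-- Row `2i` now forces opposite values at row `i`, so a nonzero difference needs both to be
nonzero. Conversely, witnesses with values `s` and `t` are scaled by `t` and `-s`: the sum cancels
and the difference is `2ts`. -/
theorem hadamardRowFree_odd {n : ℕ} {i : Fin (2 ^ n)} {C : Set (Fin (2 ^ (n + 1)))} :
    HadamardRowFree (n + 1) (evenOddEquiv n (Sum.inr i)) C ↔
      HadamardRowFree n i {j | evenOddEquiv n (Sum.inl j) ∈ C} ∧
      HadamardRowFree n i {j | evenOddEquiv n (Sum.inr j) ∈ C} := by
  have hlt : evenOddEquiv n (Sum.inl i) < evenOddEquiv n (Sum.inr i) := by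
    rw [Fin.lt_def]; simp
  constructor
  · rintro ⟨x, hxC, hx0, hxi⟩
    obtain ⟨h1, h2⟩ := hadamardMatrix_mulVec_halves_eq_zero fun k hk => hx0 k (hk.trans hlt)
    have h3 := hx0 _ hlt
    rw [hadamardMatrix_mulVec_even] at h3
    rw [hadamardMatrix_mulVec_odd] at hxi
    exact ⟨⟨_, fun j hj => hxC _ hj, h1, fun h => hxi (by linarith)⟩,
      ⟨_, fun j hj => hxC _ hj, h2, fun h => hxi (by linarith)⟩⟩
  · rintro ⟨⟨a, haC, ha0, hai⟩, ⟨b, hbC, hb0, hbi⟩⟩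
    set s := (hadamardMatrix n *ᵥ a) i
    set t := (hadamardMatrix n *ᵥ b) i
    have ha0' : ∀ k < i, (hadamardMatrix n *ᵥ (t • a)) k = 0 := fun k hk => by
      simp [Matrix.mulVec_smul, ha0 k hk]
    have hb0' : ∀ k < i, (hadamardMatrix n *ᵥ ((-s) • b)) k = 0 := fun k hk => by
      simp [Matrix.mulVec_neg, Matrix.mulVec_smul, hb0 k hk]
    refine ⟨interleave (t • a) ((-s) • b), interleave_eq_zero
      (fun j hj => by simp [haC j hj]) (fun j hj => by simp [hbC j hj]), fun k hk => ?_, ?_⟩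
    · rcases lt_or_ge k (evenOddEquiv n (Sum.inl i)) with hk' | hk'
      · exact hadamardMatrix_mulVec_interleave_eq_zero ha0' hb0' hk'
      · have : k = evenOddEquiv n (Sum.inl i) := by
          rw [Fin.ext_iff]
          rw [Fin.lt_def] at hk
          rw [Fin.le_def] at hk'
          simp at hk hk' ⊢
          omega
        rw [this, hadamardMatrix_mulVec_even]
        simp only [interleave_inl, interleave_inr]
        change (hadamardMatrix n *ᵥ (t • a)) i + (hadamardMatrix n *ᵥ ((-s) • b)) i = 0
        rw [Matrix.mulVec_smul, Matrix.mulVec_smul, Pi.smul_apply, Pi.smul_apply]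
        change t * s + -s * t = 0
        ring
    · rw [hadamardMatrix_mulVec_odd]
      simp only [interleave_inl, interleave_inr]
      change (hadamardMatrix n *ᵥ (t • a)) i - (hadamardMatrix n *ᵥ ((-s) • b)) i ≠ 0
      rw [Matrix.mulVec_smul, Matrix.mulVec_smul, Pi.smul_apply, Pi.smul_apply]
      change t * s - -s * t ≠ 0
      have : t * s - -s * t = 2 * (t * s) := by ring
      rw [this]
      exact mul_ne_zero two_ne_zero (mul_ne_zero hbi hai)

/-! ### Probabilities that rows are free. -/

theorem measurableSet_setOf_avoid {N : ℕ} {D : Set ℝ} (hD : MeasurableSet D)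
    (p : Set (Fin N) → Prop) : MeasurableSet {x : Fin N → ℝ | p {j | x j ∉ D}} := by
  have h : Measurable fun x : Fin N → ℝ => {j | x j ∉ D} :=
    measurable_set_iff.2 fun j => by
      have : Measurable fun x : Fin N → ℝ => x j ∈ Dᶜ :=
        (measurable_mem.2 hD.compl).comp (measurable_pi_apply j)
      exact this
  exact h (Set.toFinite {C | p C}).measurableSet

/-- The probability that row `i` of the Hadamard matrix is free on the columns where the source
avoids `D`. -/
noncomputable def rowFreeProb (μ : Measure ℝ) (D : Set ℝ) (n : ℕ) (i : Fin (2 ^ n)) : ℝ :=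
  (Measure.pi fun _ : Fin (2 ^ n) => μ).real {x | HadamardRowFree n i {j | x j ∉ D}}

theorem rowFreeProb_zero (μ : Measure ℝ) [IsProbabilityMeasure μ] {D : Set ℝ}
    (i : Fin (2 ^ 0)) : rowFreeProb μ D 0 i = μ.real Dᶜ := by
  have hi : ∀ j : Fin (2 ^ 0), j = i := fun j => Subsingleton.elim (α := Fin 1) j i
  have hsum : ∀ x : Fin (2 ^ 0) → ℝ, (hadamardMatrix 0 *ᵥ x) i = x i := fun x => by
    simp [Matrix.mulVec, dotProduct, hadamardMatrix, hi default]
  have h : {x : Fin (2 ^ 0) → ℝ | HadamardRowFree 0 i {j | x j ∉ D}} =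
      Set.univ.pi fun _ => Dᶜ := by
    ext x
    simp only [Set.mem_ofPred_eq, Set.mem_univ_pi, Set.mem_compl_iff]
    constructor
    · rintro ⟨y, hy, -, hyi⟩ j hj
      rw [hsum, ← hi j] at hyi
      exact hyi (hy j fun h => h hj)
    · intro hx
      refine ⟨fun _ => 1, fun j hj => absurd (hx j) hj, fun k hk => ?_, ?_⟩
      · exact absurd hk (by rw [hi k]; exact lt_irrefl _)
      · rw [hsum]; exact one_ne_zero
  rw [rowFreeProb, h, measureReal_def, Measure.pi_pi]
  simp [measureReal_def]

theorem measurePreserving_evenOdd (μ : Measure ℝ) [IsProbabilityMeasure μ] (n : ℕ) :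
    MeasurePreserving (fun x : Fin (2 ^ (n + 1)) → ℝ =>
      ((fun j => x (evenOddEquiv n (Sum.inl j))), fun j => x (evenOddEquiv n (Sum.inr j))))
      (Measure.pi fun _ => μ) ((Measure.pi fun _ => μ).prod (Measure.pi fun _ => μ)) :=
  (measurePreserving_sumPiEquivProdPi fun _ => μ).comp
    (measurePreserving_piCongrLeft (fun _ => μ) (evenOddEquiv n)).symm

theorem rowFreeProb_odd (μ : Measure ℝ) [IsProbabilityMeasure μ] {D : Set ℝ}
    (hD : MeasurableSet D) {n : ℕ} (i : Fin (2 ^ n)) :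
    rowFreeProb μ D (n + 1) (evenOddEquiv n (Sum.inr i)) = rowFreeProb μ D n i ^ 2 := by
  have hS := measurableSet_setOf_avoid hD (HadamardRowFree n i)
  simp only [rowFreeProb, hadamardRowFree_odd]
  rw [sq, ← measureReal_prod_prod, ← (measurePreserving_evenOdd μ n).measureReal_preimage
    (hS.prod hS).nullMeasurableSet]
  rfl

theorem rowFreeProb_even (μ : Measure ℝ) [IsProbabilityMeasure μ] {D : Set ℝ}
    (hD : MeasurableSet D) {n : ℕ} (i : Fin (2 ^ n)) :
    rowFreeProb μ D (n + 1) (evenOddEquiv n (Sum.inl i)) =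
      2 * rowFreeProb μ D n i - rowFreeProb μ D n i ^ 2 := by
  have hS := measurableSet_setOf_avoid hD (HadamardRowFree n i)
  have hS' := measurableSet_setOf_avoid hD
    (HadamardRowFree (n + 1) (evenOddEquiv n (Sum.inl i)))
  -- Row `2i` fails to be free iff row `i` fails on both independent halves.
  have h : (Measure.pi fun _ => μ).real
      {x : Fin (2 ^ (n + 1)) → ℝ |
        HadamardRowFree (n + 1) (evenOddEquiv n (Sum.inl i)) {j | x j ∉ D}}ᶜ =
      (1 - rowFreeProb μ D n i) ^ 2 := by
    rw [rowFreeProb, ← probReal_compl_eq_one_sub hS, sq, ← measureReal_prod_prod,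
      ← (measurePreserving_evenOdd μ n).measureReal_preimage
        (hS.compl.prod hS.compl).nullMeasurableSet]
    congr 1
    ext x
    simp only [Set.mem_compl_iff, Set.mem_ofPred_eq, hadamardRowFree_even, not_or]
    rfl
  rw [probReal_compl_eq_one_sub hS'] at h
  change 1 - rowFreeProb μ D (n + 1) (evenOddEquiv n (Sum.inl i)) = _ at h
  linarith

/-! ### Polarization. -/

/-- The polarization of the erasure probabilities: `a` splits into `2a - a²` and `a²`. -/
structure IsErasureProcess (d : ℝ) (a : (n : ℕ) → Fin (2 ^ n) → ℝ) : Prop where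
  zero : ∀ i, a 0 i = d
  even : ∀ n i, a (n + 1) (evenOddEquiv n (Sum.inl i)) = 2 * a n i - a n i ^ 2
  odd : ∀ n i, a (n + 1) (evenOddEquiv n (Sum.inr i)) = a n i ^ 2

/-- With `u = x(1-x)` factored out, the squared sum of the two remaining roots is `2 - 2u +
2√(u(2+u))`, and `√(u(2+u)) ≤ 1/2 + u` amounts to `u ≤ 1/4`. The point is that `√3 < 2`, so the
average of `√(p(1-p))` over the rows decays. -/
theorem sqrt_polarize_le {x : ℝ} (h0 : 0 ≤ x) (h1 : x ≤ 1) :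
    √((2 * x - x ^ 2) * (1 - (2 * x - x ^ 2))) + √(x ^ 2 * (1 - x ^ 2)) ≤
      √3 * √(x * (1 - x)) := by
  set u := x * (1 - x) with hu
  have hu0 : 0 ≤ u := mul_nonneg h0 (by linarith)
  have hu1 : u ≤ 1 / 4 := by nlinarith [sq_nonneg (2 * x - 1)]
  have e1 : (2 * x - x ^ 2) * (1 - (2 * x - x ^ 2)) = u * ((2 - x) * (1 - x)) := by rw [hu]; ring
  have e2 : x ^ 2 * (1 - x ^ 2) = u * (x * (1 + x)) := by rw [hu]; ring
  rw [e1, e2, Real.sqrt_mul hu0, Real.sqrt_mul hu0, ← mul_add, mul_comm (√3)]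
  refine mul_le_mul_of_nonneg_left ?_ (Real.sqrt_nonneg _)
  refine Real.le_sqrt_of_sq_le ?_
  have n1 : 0 ≤ (2 - x) * (1 - x) := mul_nonneg (by linarith) (by linarith)
  have n2 : 0 ≤ x * (1 + x) := mul_nonneg h0 (by linarith)
  rw [add_sq, Real.sq_sqrt n1, Real.sq_sqrt n2, mul_assoc, ← Real.sqrt_mul n1]
  have h2 : √((2 - x) * (1 - x) * (x * (1 + x))) ≤ 1 / 2 + u := by
    rw [Real.sqrt_le_left (by linarith)]
    have : (2 - x) * (1 - x) * (x * (1 + x)) = u * (2 + u) := by rw [hu]; ring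
    rw [this]
    nlinarith
  have h3 : (2 - x) * (1 - x) + x * (1 + x) = 2 - 2 * u := by rw [hu]; ring
  linarith

namespace IsErasureProcess

variable {d : ℝ} {a : (n : ℕ) → Fin (2 ^ n) → ℝ}

theorem mem_Icc (h : IsErasureProcess d a) (hd : d ∈ Set.Icc (0 : ℝ) 1) :
    ∀ n i, a n i ∈ Set.Icc (0 : ℝ) 1
  | 0, i => by rw [h.zero]; exact hd
  | n + 1, i => by
    obtain ⟨j | j, rfl⟩ := (evenOddEquiv n).surjective i
    · obtain ⟨h0, h1⟩ := h.mem_Icc hd n j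
      rw [h.even]
      constructor <;> nlinarith
    · obtain ⟨h0, h1⟩ := h.mem_Icc hd n j
      rw [h.odd]
      constructor <;> nlinarith

/-- This serves the threshold 1, which `tendsto_card_div` excludes. -/
theorem eq_one (h : IsErasureProcess 1 a) : ∀ n i, a n i = 1
  | 0, i => h.zero i
  | n + 1, i => by
    obtain ⟨j | j, rfl⟩ := (evenOddEquiv n).surjective i
    · rw [h.even, h.eq_one n j]; norm_num
    · rw [h.odd, h.eq_one n j]; norm_num

theorem sum_eq (h : IsErasureProcess d a) : ∀ n, ∑ i, a n i = 2 ^ n * d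
  | 0 => by simp [h.zero]
  | n + 1 => by
    rw [← (evenOddEquiv n).sum_comp, Fintype.sum_sum_type, ← Finset.sum_add_distrib]
    simp only [h.even, h.odd, sub_add_cancel]
    rw [← Finset.mul_sum, h.sum_eq n]
    ring

theorem sum_sqrt_le (h : IsErasureProcess d a) (hd : d ∈ Set.Icc (0 : ℝ) 1) :
    ∀ n, ∑ i, √(a n i * (1 - a n i)) ≤ √3 ^ n
  | 0 => by
    obtain ⟨h0, h1⟩ := hd
    have : d * (1 - d) ≤ 1 := by nlinarith
    simp [h.zero, this]
  | n + 1 => by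
    rw [← (evenOddEquiv n).sum_comp, Fintype.sum_sum_type, ← Finset.sum_add_distrib]
    simp only [h.even, h.odd]
    calc _ ≤ ∑ i, √3 * √(a n i * (1 - a n i)) := Finset.sum_le_sum fun i _ =>
          sqrt_polarize_le (h.mem_Icc hd n i).1 (h.mem_Icc hd n i).2
      _ = √3 * ∑ i, √(a n i * (1 - a n i)) := (Finset.mul_sum _ _ _).symm
      _ ≤ √3 * √3 ^ n := mul_le_mul_of_nonneg_left (h.sum_sqrt_le hd n) (Real.sqrt_nonneg _)
      _ = _ := by ring

/-- The error of replacing `a` by the indicator of `a ≥ θ` is at most a constant times `√(a(1-a))`: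
if `a ≥ θ` then `θ(1-a) ≤ a`, and if `a < θ` then `(1-θ)a ≤ 1-a`. Averaged over the rows this is
`O((√3/2)^n)`, while the average of `a` is exactly `d`. -/
theorem tendsto_card_div (h : IsErasureProcess d a) (hd : d ∈ Set.Icc (0 : ℝ) 1) {θ : ℝ}
    (h0 : 0 < θ) (h1 : θ < 1) (S : (n : ℕ) → Finset (Fin (2 ^ n)))
    (hS : ∀ n i, i ∈ S n ↔ θ ≤ a n i) :
    Tendsto (fun n => ((S n).card : ℝ) / 2 ^ n) atTop (𝓝 d) := by
  classical
  set c := (√(min θ (1 - θ)))⁻¹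
  have hmin : 0 < min θ (1 - θ) := lt_min h0 (by linarith)
  have hpt : ∀ n i, |(if i ∈ S n then 1 else 0) - a n i| ≤ c * √(a n i * (1 - a n i)) := by
    intro n i
    obtain ⟨ha0, ha1⟩ := h.mem_Icc hd n i
    set x := a n i
    rw [inv_mul_eq_div, le_div_iff₀ (Real.sqrt_pos.2 hmin)]
    refine Real.le_sqrt_of_sq_le ?_
    rw [mul_pow, sq_abs, Real.sq_sqrt hmin.le]
    split_ifs with hi
    · rw [hS] at hi
      have := min_le_left θ (1 - θ)
      have e : x * (1 - x) - (1 - x) ^ 2 * θ = (1 - x) * (x - θ + θ * x) := by ring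
      have : 0 ≤ (1 - x) * (x - θ + θ * x) :=
        mul_nonneg (by linarith) (by nlinarith)
      nlinarith [sq_nonneg (1 - x)]
    · rw [hS, not_le] at hi
      have := min_le_right θ (1 - θ)
      have e : x * (1 - x) - x ^ 2 * (1 - θ) = x * (1 - x - x + x * θ) := by ring
      have : 0 ≤ x * (1 - x - x * (1 - θ)) := mul_nonneg ha0 (by nlinarith)
      nlinarith [sq_nonneg x]
  have hbound : ∀ n, |((S n).card : ℝ) / 2 ^ n - d| ≤ c * (√3 / 2) ^ n := by
    intro n
    have hcard : ((S n).card : ℝ) = ∑ i, if i ∈ S n then 1 else 0 := by simp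
    have e : ((S n).card : ℝ) / 2 ^ n - d =
        (∑ i, ((if i ∈ S n then 1 else 0) - a n i)) / 2 ^ n := by
      rw [Finset.sum_sub_distrib, h.sum_eq, ← hcard]
      field_simp
    rw [e, abs_div, abs_of_pos (by positivity : (0 : ℝ) < 2 ^ n), div_le_iff₀ (by positivity),
      div_pow, mul_assoc, div_mul_cancel₀ _ (by positivity)]
    calc _ ≤ ∑ i, |(if i ∈ S n then 1 else 0) - a n i| := Finset.abs_sum_le_sum_abs _ _
      _ ≤ ∑ i, c * √(a n i * (1 - a n i)) := Finset.sum_le_sum fun i _ => hpt n i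
      _ = c * ∑ i, √(a n i * (1 - a n i)) := (Finset.mul_sum _ _ _).symm
      _ ≤ _ := mul_le_mul_of_nonneg_left (h.sum_sqrt_le hd n)
          (inv_nonneg.2 (Real.sqrt_nonneg _))
  rw [tendsto_iff_norm_sub_tendsto_zero]
  refine squeeze_zero (fun _ => norm_nonneg _) hbound ?_
  have h3 : √3 / 2 < 1 := by
    rw [div_lt_one two_pos, Real.sqrt_lt' two_pos]
    norm_num
  simpa using (tendsto_pow_atTop_nhds_zero_of_lt_one (by positivity) h3).const_mul c

end IsErasureProcess

theorem isErasureProcess_rowFreeProb (μ : Measure ℝ) [IsProbabilityMeasure μ] {D : Set ℝ}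
    (hD : MeasurableSet D) : IsErasureProcess (μ.real Dᶜ) (rowFreeProb μ D) where
  zero := rowFreeProb_zero μ
  even _ := rowFreeProb_even μ hD
  odd _ := rowFreeProb_odd μ hD

/-! ### Entropy without information, and of independent variables. -/

theorem condShannonEntropy_of_subsingleton {Ω E F : Type*} [MeasurableSpace Ω]
    [MeasurableSpace E] [StandardBorelSpace E] [Nonempty E] [MeasurableSpace F] [Subsingleton F]
    (P : Measure Ω) [IsProbabilityMeasure P] {D : Ω → E} (hD : Measurable D) {Y : Ω → F}
    (hY : Measurable Y) : condShannonEntropy P D Y = shannonEntropy (P.map D) := by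
  have : IsProbabilityMeasure (P.map Y) := Measure.isProbabilityMeasure_map hY.aemeasurable
  have h : ∀ y, condDistrib D Y P y = P.map D := fun y => by
    rw [← condDistrib_comp_map hY.aemeasurable hD.aemeasurable]
    ext s hs
    rw [Measure.bind_apply hs (Kernel.aemeasurable _)]
    have : ∀ z, condDistrib D Y P z s = condDistrib D Y P y s := fun z => by
      rw [Subsingleton.elim z y]
    simp [this]
  simp [condShannonEntropy, h]

/-- Used with a one-point index type, to apply the vector-valued upper bound to a single
measurement. -/
theorem shannonEntropy_map_const_fun {α ι : Type*} [MeasurableSpace α] [Finite ι] [Nonempty ι]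
    (κ : Measure α) [IsFiniteMeasure κ] {D : α → ℝ} (hD : Measurable D)
    (hK : (Set.range D).Countable) :
    shannonEntropy (κ.map fun x (_ : ι) => D x) = shannonEntropy (κ.map D) := by
  have hD' : Measurable fun x (_ : ι) => D x := measurable_pi_lambda _ fun _ => hD
  have hK' : (Set.range fun x (_ : ι) => D x).Countable := by
    refine (hK.image fun v (_ : ι) => v).mono ?_
    rintro _ ⟨x, rfl⟩
    exact ⟨D x, ⟨x, rfl⟩, rfl⟩
  rw [shannonEntropy_map_eq_lintegral κ hD hK, shannonEntropy_map_eq_lintegral κ hD' hK']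
  refine lintegral_congr fun x => ?_
  rw [map_measureReal_apply hD (measurableSet_singleton _),
    map_measureReal_apply hD' (measurableSet_singleton _)]
  congr 4
  ext y
  simp [funext_iff]

/-- The entropy of independent discrete random variables is additive. -/
theorem shannonEntropy_map_pi {Ω E ι : Type*} [MeasurableSpace Ω] [MeasurableSpace E]
    [MeasurableSingletonClass E] [Fintype ι] (P : Measure Ω) [IsProbabilityMeasure P]
    {D : ι → Ω → E} (hD : ∀ j, Measurable (D j)) (hK : ∀ j, (Set.range (D j)).Countable)
    (hind : iIndepFun D P) :
    shannonEntropy (P.map fun ω j => D j ω) = ∑ j, shannonEntropy (P.map (D j)) := by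
  have hDpi : Measurable fun ω j => D j ω := measurable_pi_lambda _ hD
  have hKpi : (Set.range fun ω j => D j ω).Countable := by
    refine (Set.countable_univ_pi hK).mono ?_
    rintro _ ⟨x, rfl⟩ j -
    exact ⟨_, rfl⟩
  have hprob : ∀ j, IsProbabilityMeasure (P.map (D j)) := fun j =>
    Measure.isProbabilityMeasure_map (hD j).aemeasurable
  have hm : ∀ j, Measurable fun ω =>
      ENNReal.ofReal (-Real.log ((P.map (D j)).real {D j ω})) := fun j =>
    measurable_comp_of_countable_range (hD j) (hK j)
      fun v => ENNReal.ofReal (-Real.log ((P.map (D j)).real {v}))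
  rw [shannonEntropy_map_eq_lintegral P hDpi hKpi]
  simp_rw [fun j => shannonEntropy_map_eq_lintegral P (hD j) (hK j)]
  rw [← lintegral_finsetSum _ fun j _ => hm j]
  refine lintegral_congr_ae ?_
  filter_upwards [ae_all_iff.2 fun j => ae_map_singleton_pos P (hD j) (hK j)] with ω hω
  rw [hind.map_fun_eq_pi_map fun j => (hD j).aemeasurable, measureReal_def, Measure.pi_singleton,
    ENNReal.toReal_prod]
  simp_rw [← measureReal_def]
  rw [Real.log_prod fun j _ => (hω j).ne', ← Finset.sum_neg_distrib,
    ENNReal.ofReal_sum_of_nonneg fun j _ => ?_]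
  exact neg_nonneg.2 (Real.log_nonpos measureReal_nonneg measureReal_le_one)

/-! ### Dimension counts through free rows. -/

/-- The rows `s` of the Hadamard matrix, as a linear map. -/
noncomputable def hadamardRows {σ : Type*} (n : ℕ) (s : σ → Fin (2 ^ n)) :
    (Fin (2 ^ n) → ℝ) →ₗ[ℝ] (σ → ℝ) :=
  LinearMap.funLeft ℝ ℝ s ∘ₗ (hadamardMatrix n).mulVecLin

theorem exists_supportedKer_iff {n : ℕ} {i : Fin (2 ^ n)} {C : Set (Fin (2 ^ n))} :
    (∃ x ∈ supportedKer (hadamardRows n fun j : {j // j < i} => j.1) C,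
      (hadamardMatrix n *ᵥ x) i ≠ 0) ↔ HadamardRowFree n i C := by
  constructor
  · rintro ⟨x, ⟨h1, h2⟩, h3⟩
    exact ⟨x, h1, fun k hk => congrFun h2 ⟨k, hk⟩, h3⟩
  · rintro ⟨x, h1, h2, h3⟩
    exact ⟨x, ⟨h1, funext fun k => h2 k.1 k.2⟩, h3⟩

open Classical in
theorem finrank_supportedKer_map_row_le {n : ℕ} (i : Fin (2 ^ n)) (C : Set (Fin (2 ^ n))) :
    Module.finrank ℝ ((supportedKer (hadamardRows n fun j : {j // j < i} => j.1) C).map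
      (hadamardRows n fun _ : Unit => i)) ≤ if HadamardRowFree n i C then 1 else 0 := by
  split_ifs with h
  · refine (Submodule.finrank_le _).trans ?_
    simp
  · rw [← exists_supportedKer_iff] at h
    push Not at h
    have : (supportedKer (hadamardRows n fun j : {j // j < i} => j.1) C).map
        (hadamardRows n fun _ : Unit => i) = ⊥ := by
      refine (Submodule.eq_bot_iff _).2 ?_
      rintro _ ⟨x, hx, rfl⟩
      exact funext fun _ => h x hx
    rw [this, finrank_bot]

-- For a nonzero `x` in the kernel, the first row not annihilating `x` is free on `C`, with `x`
-- itself as witness, and is not in `S`. Hence the measurements at the free rows outside `S`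
-- determine `x`.
open Classical in
theorem finrank_supportedKer_rows_le {n : ℕ} (S : Finset (Fin (2 ^ n))) {σ : Type*}
    {s : σ → Fin (2 ^ n)} (hs : ∀ i ∈ S, ∃ k, s k = i) (C : Set (Fin (2 ^ n))) :
    Module.finrank ℝ (supportedKer (hadamardRows n s) C) ≤
      (Finset.univ.filter fun i => i ∉ S ∧ HadamardRowFree n i C).card := by
  set T := Finset.univ.filter fun i => i ∉ S ∧ HadamardRowFree n i C
  have hinj : Function.Injective ((hadamardRows n fun i : T => i.1) ∘ₗ
      (supportedKer (hadamardRows n s) C).subtype) := by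
    rw [injective_iff_map_eq_zero]
    rintro ⟨x, hxC, hxS⟩ hx
    refine Subtype.ext (hadamardMatrix_mulVec_injective n x ?_)
    by_contra hne
    have hex : (Finset.univ.filter fun i => (hadamardMatrix n *ᵥ x) i ≠ 0).Nonempty := by
      obtain ⟨i, hi⟩ := Function.ne_iff.1 hne
      exact ⟨i, Finset.mem_filter.2 ⟨Finset.mem_univ _, hi⟩⟩
    obtain ⟨i, hi, hmin⟩ := Finset.exists_min_image _ id hex
    have hi0 : (hadamardMatrix n *ᵥ x) i ≠ 0 := (Finset.mem_filter.1 hi).2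
    have hiT : i ∈ T := by
      refine Finset.mem_filter.2 ⟨Finset.mem_univ _, fun hiS => ?_, x, hxC, fun k hk => ?_, hi0⟩
      · obtain ⟨k, rfl⟩ := hs i hiS
        exact hi0 (congrFun hxS k)
      · by_contra hk0
        exact absurd (hmin k (Finset.mem_filter.2 ⟨Finset.mem_univ _, hk0⟩)) (not_le.2 hk)
    exact hi0 (congrFun hx ⟨i, hiT⟩)
  have := LinearMap.finrank_le_finrank_of_injective hinj
  simpa using this

theorem IsNonsingularLaw.exists_countable {μ : Measure ℝ} (h : IsNonsingularLaw μ) :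
    ∃ D : Set ℝ, D.Countable ∧ μ.restrict Dᶜ ≪ volume := by
  obtain ⟨μd, μc, rfl, ⟨D, hD, hd⟩, hc⟩ := h
  refine ⟨D, hD, ?_⟩
  rw [Measure.restrict_add, Measure.restrict_eq_zero.2 hd, zero_add]
  exact Measure.absolutelyContinuous_of_le Measure.restrict_le_self |>.trans hc

theorem map_fin_eq_pi {Ω : Type*} [MeasurableSpace Ω] {P : Measure Ω} {X : ℕ → Ω → ℝ}
    (hmeas : ∀ i, Measurable (X i)) (hindep : iIndepFun X P)
    (hident : ∀ i, IdentDistrib (X i) (X 0) P P) (N : ℕ) :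
    P.map (fun ω (j : Fin N) => X j ω) = Measure.pi fun _ => P.map (X 0) := by
  have h : iIndepFun (fun j : Fin N => X j) P := hindep.precomp Fin.val_injective
  refine (iIndepFun.map_fun_eq_pi_map (f := fun j : Fin N => X j)
    (fun j => (hmeas j).aemeasurable) h).trans ?_
  congr 1
  ext1 j
  exact (hident j).map_eq

/-! ### Information dimensions of the source and the REP property. -/

section Source

variable {Ω : Type*} [MeasurableSpace Ω] {P : Measure Ω} [IsProbabilityMeasure P]
  {X : ℕ → Ω → ℝ} {D : Set ℝ}

theorem measure_hadamardRowFree (hmeas : ∀ i, Measurable (X i)) (hindep : iIndepFun X P)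
    (hident : ∀ i, IdentDistrib (X i) (X 0) P P) (hD : D.Countable) (n : ℕ) (i : Fin (2 ^ n)) :
    P {ω | HadamardRowFree n i {j : Fin (2 ^ n) | X j ω ∉ D}} =
      ENNReal.ofReal (rowFreeProb (P.map (X 0)) D n i) := by
  have : IsProbabilityMeasure (P.map (X 0)) :=
    Measure.isProbabilityMeasure_map (hmeas 0).aemeasurable
  rw [rowFreeProb, ofReal_measureReal, ← map_fin_eq_pi hmeas hindep hident,
    Measure.map_apply (measurable_pi_lambda _ fun j : Fin (2 ^ n) => hmeas j)
      (measurableSet_setOf_avoid hD.measurableSet _)]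
  rfl

theorem measurableSet_hadamardRowFree (hmeas : ∀ i, Measurable (X i)) (hD : D.Countable) (n : ℕ)
    (i : Fin (2 ^ n)) :
    MeasurableSet {ω | HadamardRowFree n i {j : Fin (2 ^ n) | X j ω ∉ D}} :=
  (measurable_pi_lambda (fun ω (j : Fin (2 ^ n)) => X j ω) fun j => hmeas j)
    (measurableSet_setOf_avoid hD.measurableSet (HadamardRowFree n i))

theorem hasCondRID_hadamardMeasurement (hmeas : ∀ i, Measurable (X i)) (hindep : iIndepFun X P)
    (hident : ∀ i, IdentDistrib (X i) (X 0) P P) (hL2 : MemLp (X 0) 2 P) (hD : D.Countable)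
    (hac : (P.map (X 0)).restrict Dᶜ ≪ volume) (n : ℕ) (i : Fin (2 ^ n)) :
    HasCondRID P (fun ω => hadamardMeasurement X n ω i)
      (fun ω (j : {j : Fin (2 ^ n) // j < i}) => hadamardMeasurement X n ω j)
      (rowFreeProb (P.map (X 0)) D n i).toNNReal := by
  classical
  have : IsProbabilityMeasure (P.map (X 0)) :=
    Measure.isProbabilityMeasure_map (hmeas 0).aemeasurable
  set U : Ω → Fin (2 ^ n) → ℝ := fun ω j => X j ω
  have hU : Measurable U := measurable_pi_lambda _ fun j => hmeas j
  have hU2 : ∀ j, MemLp (fun ω => U ω j) 2 P := fun j => (hident j).symm.memLp_iff.1 hL2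
  set A := hadamardRows n fun j : {j // j < i} => j.1
  set ℓ : (Fin (2 ^ n) → ℝ) →ₗ[ℝ] ℝ := LinearMap.proj i ∘ₗ (hadamardMatrix n).mulVecLin
  have hZ : Measurable fun ω => ℓ (U ω) := ℓ.continuous_of_finiteDimensional.measurable.comp hU
  have hY : Measurable fun ω => A (U ω) := A.continuous_of_finiteDimensional.measurable.comp hU
  have hP := measure_hadamardRowFree hmeas hindep hident hD n i
  change Tendsto (fun q : ℕ => condShannonEntropy P (fun ω => quantize q (ℓ (U ω)))
    (fun ω => A (U ω)) / ENNReal.ofReal (Real.log q)) atTop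
      (𝓝 (ENNReal.ofReal (rowFreeProb (P.map (X 0)) D n i)))
  refine tendsto_of_le_liminf_of_limsup_le ?_ ?_
  · rw [← hP]
    refine le_liminf_condShannonEntropy_div_log P hY hZ fun G hG hG0 => ?_
    have h := measure_supportedKer_inter_eq_zero P hU (map_fin_eq_pi hmeas hindep hident (2 ^ n))
      hD.measurableSet hac A ℓ hG hG0
    refine measure_mono_null (Set.inter_subset_inter_left _ fun ω hω => ?_) h
    exact exists_supportedKer_iff.2 hω
  · have h := limsup_condShannonEntropy_div_log_le P hU hU2 hD A
      (hadamardRows n fun _ : Unit => i)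
    have hscalar : ∀ q : ℕ, condShannonEntropy P
        (fun ω j => quantize q (hadamardRows n (fun _ : Unit => i) (U ω) j))
        (fun ω => A (U ω)) = condShannonEntropy P (fun ω => quantize q (ℓ (U ω)))
        (fun ω => A (U ω)) := fun q => by
      rw [condShannonEntropy_comp P hZ _ (measurable_quantize q)]
      refine (condShannonEntropy_comp P hZ (fun ω => A (U ω))
        (D := fun z (_ : Unit) => quantize q z)
        (measurable_pi_lambda _ fun _ => measurable_quantize q)).trans ?_
      refine lintegral_congr fun y => ?_
      exact shannonEntropy_map_const_fun _ (measurable_quantize q) (countable_range_quantize q)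
    simp_rw [hscalar] at h
    refine h.trans ?_
    rw [← hP, ← lintegral_indicator_one (measurableSet_hadamardRowFree hmeas hD n i)]
    refine lintegral_mono fun ω => ?_
    have := finrank_supportedKer_map_row_le i {j : Fin (2 ^ n) | X j ω ∉ D}
    simp only [Set.indicator_apply, Set.mem_ofPred_eq, Pi.one_apply]
    split_ifs at this ⊢ <;> exact_mod_cast this

/-- This is the case `N = 1`, where the only measurement is `X 0` itself and nothing is conditioned
on. -/
theorem hasRID_source (hmeas : ∀ i, Measurable (X i)) (hindep : iIndepFun X P)
    (hident : ∀ i, IdentDistrib (X i) (X 0) P P) (hL2 : MemLp (X 0) 2 P) (hD : D.Countable)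
    (hac : (P.map (X 0)).restrict Dᶜ ≪ volume) :
    HasRID P (X 0) ((P.map (X 0)).real Dᶜ).toNNReal := by
  have : IsProbabilityMeasure (P.map (X 0)) :=
    Measure.isProbabilityMeasure_map (hmeas 0).aemeasurable
  have h := hasCondRID_hadamardMeasurement hmeas hindep hident hL2 hD hac 0 0
  have hZ : (fun ω => hadamardMeasurement X 0 ω 0) = X 0 := by
    ext ω
    have : (0 : Fin (2 ^ 0)) = default := Subsingleton.elim (α := Fin 1) _ _
    simp [hadamardMeasurement, Matrix.mulVec, dotProduct, hadamardMatrix]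
  have : IsEmpty {j : Fin (2 ^ 0) // j < 0} := ⟨fun j => absurd j.2 (Fin.not_lt_zero _)⟩
  rw [rowFreeProb_zero, hZ] at h
  refine h.congr fun q => ?_
  rw [condShannonEntropy_of_subsingleton P (D := fun ω => quantize q (X 0 ω))
    ((measurable_quantize q).comp (hmeas 0)) (measurable_pi_iff.2 fun j => isEmptyElim j)]

theorem tendsto_shannonEntropy_source_div_log (hmeas : ∀ i, Measurable (X i))
    (hindep : iIndepFun X P) (hident : ∀ i, IdentDistrib (X i) (X 0) P P) {d : ℝ≥0}
    (hd : HasRID P (X 0) d) (N : ℕ) :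
    Tendsto (fun q : ℕ => shannonEntropy (P.map (fun ω (i : Fin N) => quantize q (X i ω))) /
      ENNReal.ofReal (Real.log q)) atTop (𝓝 (N * d)) := by
  refine (ENNReal.Tendsto.const_mul hd (Or.inr (ENNReal.natCast_ne_top N))).congr fun q => ?_
  have h : iIndepFun (fun (j : Fin N) ω => quantize q (X j ω)) P :=
    (hindep.precomp Fin.val_injective (g := fun j : Fin N => (j : ℕ))).comp
      (fun _ => quantize q) fun _ => measurable_quantize q
  rw [shannonEntropy_map_pi P (D := fun (j : Fin N) ω => quantize q (X j ω))
    (fun j => (measurable_quantize q).comp (hmeas j)) (fun j => (countable_range_quantize q).mono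
      (Set.range_comp_subset_range (X j) (quantize q))) h]
  have heq : ∀ j : Fin N, P.map (fun ω => quantize q (X j ω)) =
      P.map (fun ω => quantize q (X 0 ω)) := fun j =>
    ((hident j).comp (measurable_quantize q)).map_eq
  simp [heq, mul_div_assoc]

/-- Discarding the rows outside `S` costs at most the sum of their information dimensions. -/
theorem limsup_condShannonEntropy_partialHadamard_le (hmeas : ∀ i, Measurable (X i))
    (hindep : iIndepFun X P) (hident : ∀ i, IdentDistrib (X i) (X 0) P P)
    (hL2 : MemLp (X 0) 2 P) (hD : D.Countable) (n : ℕ) (S : Finset (Fin (2 ^ n))) :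
    limsup (fun q : ℕ => condShannonEntropy P (fun ω (i : Fin (2 ^ n)) => quantize q (X i ω))
        (fun ω => partialHadamard n S *ᵥ fun i : Fin (2 ^ n) => X i ω) /
          ENNReal.ofReal (Real.log q)) atTop ≤
      ∑ i with i ∉ S, ENNReal.ofReal (rowFreeProb (P.map (X 0)) D n i) := by
  classical
  set U : Ω → Fin (2 ^ n) → ℝ := fun ω j => X j ω
  have hU : Measurable U := measurable_pi_lambda _ fun j => hmeas j
  have hU2 : ∀ j, MemLp (fun ω => U ω j) 2 P := fun j => (hident j).symm.memLp_iff.1 hL2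
  refine (limsup_condShannonEntropy_div_log_le P hU hU2 hD
    (hadamardRows n (S.orderEmbOfFin rfl)) LinearMap.id).trans ?_
  have hS : ∀ i ∈ S, ∃ k, S.orderEmbOfFin rfl k = i := fun i hi => by
    have : i ∈ Set.range (S.orderEmbOfFin rfl) := by
      rw [Finset.range_orderEmbOfFin]; exact hi
    exact this
  calc _ ≤ ∫⁻ ω, ∑ i with i ∉ S,
          {ω | HadamardRowFree n i {j : Fin (2 ^ n) | X j ω ∉ D}}.indicator 1 ω ∂P := by
        refine lintegral_mono fun ω => ?_
        have h := finrank_supportedKer_rows_le S hS {j : Fin (2 ^ n) | X j ω ∉ D}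
        rw [Submodule.map_id]
        refine (Nat.cast_le.2 h).trans (le_of_eq ?_)
        rw [← Finset.filter_filter]
        simp [Set.indicator_apply]
    _ = _ := by
        rw [lintegral_finsetSum _ fun i _ => measurable_one.indicator
          (measurableSet_hadamardRowFree hmeas hD n i)]
        refine Finset.sum_congr rfl fun i _ => ?_
        rw [lintegral_indicator_one (measurableSet_hadamardRowFree hmeas hD n i),
          measure_hadamardRowFree hmeas hindep hident hD n i]

theorem isREP_partialHadamard (hmeas : ∀ i, Measurable (X i))
    (hindep : iIndepFun X P) (hident : ∀ i, IdentDistrib (X i) (X 0) P P)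
    (hL2 : MemLp (X 0) 2 P) (hD : D.Countable) (hac : (P.map (X 0)).restrict Dᶜ ≪ volume)
    (hpos : 0 < (P.map (X 0)).real Dᶜ) {ε : ℝ} (hε : 0 < ε)
    (hε1 : ε * (P.map (X 0)).real Dᶜ < 1 ∨ ε = 1) (S : (n : ℕ) → Finset (Fin (2 ^ n)))
    (hS : ∀ n i, i ∈ S n ↔ ε * (P.map (X 0)).real Dᶜ ≤ rowFreeProb (P.map (X 0)) D n i) :
    IsREP P X ε ((P.map (X 0)).real Dᶜ).toNNReal (fun n => 2 ^ n) (fun n => (S n).card)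
      (fun n => partialHadamard n (S n)) := by
  have : IsProbabilityMeasure (P.map (X 0)) :=
    Measure.isProbabilityMeasure_map (hmeas 0).aemeasurable
  have hproc := isErasureProcess_rowFreeProb (P.map (X 0)) hD.measurableSet
  have hrid := hasRID_source hmeas hindep hident hL2 hD hac
  set d := (P.map (X 0)).real Dᶜ
  have hd1 : d ≤ 1 := measureReal_le_one
  have hd : d ∈ Set.Icc (0 : ℝ) 1 := ⟨hpos.le, hd1⟩
  have hlogpos : ∀ q : ℕ, 1 < q → ENNReal.ofReal (Real.log q) ≠ 0 := fun q hq => by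
    rw [Ne, ENNReal.ofReal_eq_zero, not_le]
    exact Real.log_pos (by exact_mod_cast hq)
  refine ⟨fun _ => by positivity, pow_right_strictMono₀ one_lt_two, fun n => ?_, ?_⟩
  · set num : ℕ → ℝ≥0∞ := fun q => condShannonEntropy P
      (fun ω (i : Fin (2 ^ n)) => quantize q (X i ω))
      (fun ω => partialHadamard n (S n) *ᵥ fun i : Fin (2 ^ n) => X i ω)
    set den : ℕ → ℝ≥0∞ := fun q =>
      shannonEntropy (P.map (fun ω (i : Fin (2 ^ n)) => quantize q (X i ω)))
    set l : ℕ → ℝ≥0∞ := fun q => ENNReal.ofReal (Real.log q)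
    set Nd : ℝ≥0∞ := (2 ^ n : ℕ) * ENNReal.ofReal d
    have hNd0 : Nd ≠ 0 := mul_ne_zero (by simp) (by simpa using hpos)
    have hNdt : Nd ≠ ∞ := ENNReal.mul_ne_top (ENNReal.natCast_ne_top _) ENNReal.ofReal_ne_top
    have hden : Tendsto (fun q => (den q / l q)⁻¹) atTop (𝓝 Nd⁻¹) :=
      tendsto_inv_iff.2
        (tendsto_shannonEntropy_source_div_log hmeas hindep hident hrid (2 ^ n))
    have hnum : limsup (fun q => num q / l q) atTop ≤ ENNReal.ofReal ε * Nd := by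
      refine (limsup_condShannonEntropy_partialHadamard_le hmeas hindep hident hL2 hD n
        (S n)).trans ?_
      calc _ ≤ ∑ i with i ∉ S n, ENNReal.ofReal (ε * d) := by
            refine Finset.sum_le_sum fun i hi => ENNReal.ofReal_le_ofReal ?_
            have := (Finset.mem_filter.1 hi).2
            rw [hS, not_le] at this
            exact this.le
        _ ≤ ∑ _i : Fin (2 ^ n), ENNReal.ofReal (ε * d) :=
            Finset.sum_le_sum_of_subset (Finset.filter_subset _ _)
        _ = _ := by
            rw [Finset.sum_const, Finset.card_univ, Fintype.card_fin, nsmul_eq_mul,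
              ENNReal.ofReal_mul hε.le]
            exact mul_left_comm _ _ _
    have hnumt : limsup (fun q => num q / l q) atTop ≠ ∞ :=
      ne_top_of_le_ne_top (ENNReal.mul_ne_top ENNReal.ofReal_ne_top hNdt) hnum
    calc limsup (fun q => num q / den q) atTop
        = limsup ((fun q => num q / l q) * fun q => (den q / l q)⁻¹) atTop := by
          refine limsup_congr ?_
          filter_upwards [eventually_gt_atTop 1] with q hq
          have hl0 := hlogpos q hq
          have hlt : l q ≠ ∞ := ENNReal.ofReal_ne_top
          rw [Pi.mul_apply, ENNReal.inv_div (Or.inl hlt) (Or.inl hl0), div_eq_mul_inv,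
            div_eq_mul_inv, div_eq_mul_inv, mul_assoc, ← mul_assoc (l q)⁻¹,
            ENNReal.inv_mul_cancel hl0 hlt, one_mul]
      _ ≤ limsup (fun q => num q / l q) atTop * limsup (fun q => (den q / l q)⁻¹) atTop := by
          refine ENNReal.limsup_mul_le' (Or.inr ?_) (Or.inl hnumt)
          rw [hden.limsup_eq]
          exact ENNReal.inv_ne_top.2 hNd0
      _ ≤ ENNReal.ofReal ε * Nd * Nd⁻¹ := by
          rw [hden.limsup_eq]
          exact mul_le_mul' hnum le_rfl
      _ = ENNReal.ofReal ε := by rw [mul_assoc, ENNReal.mul_inv_cancel hNd0 hNdt, mul_one]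
  · have hreal : Tendsto (fun n => ((S n).card : ℝ) / 2 ^ n) atTop (𝓝 d) := by
      rcases lt_or_ge (ε * d) 1 with h | h
      · exact hproc.tendsto_card_div hd (mul_pos hε hpos) h S hS
      · obtain rfl : ε = 1 := hε1.resolve_left (not_lt.2 h)
        have hd1' : d = 1 := le_antisymm hd1 (by linarith)
        rw [hd1'] at hproc hS
        have hcard : ∀ n, ((S n).card : ℝ) / 2 ^ n = 1 := fun n => by
          have : S n = Finset.univ := Finset.eq_univ_iff_forall.2 fun i => by
            rw [hS, hproc.eq_one]; norm_num
          simp [this]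
        simp [hcard, hd1']
    refine Tendsto.limsup_eq ?_
    refine (ENNReal.tendsto_ofReal hreal).congr fun n => ?_
    rw [ENNReal.ofReal_div_of_pos (by positivity), ENNReal.ofReal_natCast,
      ENNReal.ofReal_pow zero_le_two]
    simp

end Source

theorem mainTheorem6 {Ω : Type*} [MeasurableSpace Ω] (P : Measure Ω) [IsProbabilityMeasure P]
    (X : ℕ → Ω → ℝ) (hmeas : ∀ i, Measurable (X i)) (hindep : iIndepFun X P)
    (hident : ∀ i, IdentDistrib (X i) (X 0) P P) (hL2 : MemLp (X 0) 2 P)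
    (hns : IsNonsingularLaw (P.map (X 0))) :
    ∃ (d : ℝ≥0) (I : (n : ℕ) → Fin (2 ^ n) → ℝ≥0),
      HasRID P (X 0) d ∧
      (∀ (n : ℕ) (i : Fin (2 ^ n)),
        HasCondRID P (fun ω => hadamardMeasurement X n ω i)
          (fun ω (j : {j : Fin (2 ^ n) // j < i}) => hadamardMeasurement X n ω j) (I n i)) ∧
      (0 < d → ∀ ε : ℝ, 0 < ε →
        (∃ S : (n : ℕ) → Finset (Fin (2 ^ n)),
          IsREP P X ε d (fun n => 2 ^ n) (fun n => (S n).card)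
            (fun n => partialHadamard n (S n))) ∧
        ((ε * d < 1 ∨ ε = 1) →
          ∀ S : (n : ℕ) → Finset (Fin (2 ^ n)),
            (∀ n i, i ∈ S n ↔ ε * d ≤ I n i) →
            IsREP P X ε d (fun n => 2 ^ n) (fun n => (S n).card)
              (fun n => partialHadamard n (S n)))) := by
  obtain ⟨D, hD, hac⟩ := hns.exists_countable
  have hrow : ∀ n i, 0 ≤ rowFreeProb (P.map (X 0)) D n i := fun _ _ => measureReal_nonneg
  refine ⟨((P.map (X 0)).real Dᶜ).toNNReal,
    fun n i => (rowFreeProb (P.map (X 0)) D n i).toNNReal,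
    hasRID_source hmeas hindep hident hL2 hD hac,
    fun n i => hasCondRID_hadamardMeasurement hmeas hindep hident hL2 hD hac n i,
    fun hpos ε hε => ?_⟩
  simp only [Real.coe_toNNReal _ (hrow _ _), Real.coe_toNNReal _ (measureReal_nonneg
    (μ := P.map (X 0)) (s := Dᶜ)), Real.toNNReal_pos] at hpos ⊢
  refine ⟨?_, fun hε1 S hS =>
    isREP_partialHadamard hmeas hindep hident hL2 hD hac hpos hε hε1 S hS⟩
  classical
  have : IsProbabilityMeasure (P.map (X 0)) :=
    Measure.isProbabilityMeasure_map (hmeas 0).aemeasurable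
  -- For large `ε` the threshold `ε d` can exceed 1, leaving no rows and rate 0; lowering `ε` to at
  -- most 1 restores the rate `d` and only strengthens the entropy bound.
  have hmin : min ε 1 * (P.map (X 0)).real Dᶜ < 1 ∨ min ε 1 = 1 := by
    rcases lt_or_ge ε 1 with h | h
    · left
      have h1 : (P.map (X 0)).real Dᶜ ≤ 1 := measureReal_le_one
      rw [min_eq_left h.le]
      nlinarith
    · exact Or.inr (min_eq_right h)
  have hrep := isREP_partialHadamard hmeas hindep hident hL2 hD hac hpos (lt_min hε one_pos) hmin
    (fun n => Finset.univ.filter fun i => min ε 1 * (P.map (X 0)).real Dᶜ ≤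
      rowFreeProb (P.map (X 0)) D n i) (fun n i => by simp)
  exact ⟨_, hrep.pos, hrep.strictMono, fun n => (hrep.limsup_entropy_le n).trans
    (ENNReal.ofReal_le_ofReal (min_le_left _ _)), hrep.rate⟩
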